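/- **Theorem (critical regime).** Let $d\ge 1$ and let $f:\mathbb R^d\to[0,\infty)$ be a measurable, essentially bounded probability density. For each $n$ let $X_1,\dots,X_n$ be i.i.d. points of $\mathbb R^d$ with density $f$, let $r=r(n)\ge 0$, and let $\rho=\rho(n)=(p_1,p_2,\dots)$, $p_i=p_i(n)\in[0,1]$. The Vietoris–Rips complex $R(n,r)$ has as faces the nonempty sets of points whose closed balls of radius $r/2$ intersect pairwise; the Čech complex $C(n,r)$ has as faces the nonempty sets of points whose closed balls of radius $r/2$ have a common point. The soft complexes $R(n,r,\rho)$ and $C(n,r,\rho)$ are obtained by deciding independently for each potential face of dimension $i\ge1$, also independently of the points, whether to keep it (with probability $p_i$) or to delete it (with probability $1-p_i$), and retaining those faces of $R(n,r)$, respectively $C(n,r)$, that contain no deleted face. Let $\beta_k$ be the dimension of the $k$-th (unreduced) simplicial homology with coefficients in a fixed field. Fix $k\ge 0$ and $\varepsilon>0$, and assume that $nr^d\to\lambda\in(0,\infty)$ as $n\to\infty$. Then $\beta_k(R(n,r,\rho))$ and $\beta_k(C(n,r,\rho))$ are integrable for every $n$, and the following hold as $n\to\infty$. 1. If $(1-p_{k+1})\prod_{i=1}^{k}p_i^{\binom{k+2}{i+1}}\ge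 n^{-\varepsilon}$ for all large $n$, then $E\,\beta_k(R(n,r,\rho))=O(n)$ and $E\,\beta_k(R(n,r,\rho))=\Omega(n^{1-\varepsilon})$. 2. If $\prod_{i=1}^{k}p_i^{\binom{k+2}{i+1}}\ge n^{-\varepsilon}$ for all large $n$, then $E\,\beta_k(C(n,r,\rho))=O(n)$, and, if moreover $k<d$, $E\,\beta_k(C(n,r,\rho))=\Omega(n^{1-\varepsilon})$. -/

import Mathlib

open MeasureTheory ProbabilityTheory Filter Asymptotics

namespace SoftComplex

/-! ### Simplicial homology of an abstract simplicial complex on an ordered vertex set -/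

section Homology

variable (F : Type*) [Field F] {V : Type*} [Fintype V] [LinearOrder V]

/-- The unreduced simplicial boundary map: the face with vertices `v₀ < ⋯ < v_j`, `j ≥ 1`, is sent
to `∑ i, (-1) ^ i • [v₀, …, v̂ᵢ, …, v_j]`, and vertices are sent to `0`. (The exponent
`#{u ∈ σ | u < v}` is the position of `v` in `σ`.) It is defined on the free `F`-module on all
sets of vertices. -/
noncomputable def boundary : (Finset V → F) →ₗ[F] (Finset V → F) :=
  Fintype.linearCombination F fun σ =>
    if 2 ≤ σ.card then
      ∑ v ∈ σ, Pi.single (σ.erase v) ((-1 : F) ^ (σ.filter fun u => u < v).card)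
    else 0

/-- The `j`-chains of `K`: combinations of the faces of `K` with exactly `j + 1` vertices. -/
def chains (K : PreAbstractSimplicialComplex V) (j : ℕ) : Submodule F (Finset V → F) where
  carrier := {c | ∀ σ, c σ ≠ 0 → σ ∈ K ∧ σ.card = j + 1}
  zero_mem' := fun _ h => absurd rfl h
  add_mem' := fun {a b} ha hb σ h => by
    by_cases h0 : a σ = 0
    · exact hb σ fun h1 => h (by simp [h0, h1])
    · exact ha σ h0
  smul_mem' := fun t a ha σ h => ha σ fun h0 => h (by simp [h0])

/-- The `j`-cycles of `K`. -/
noncomputable def cycles (K : PreAbstractSimplicialComplex V) (j : ℕ) :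
    Submodule F (Finset V → F) :=
  chains F K j ⊓ LinearMap.ker (boundary F)

/-- The `j`-boundaries of `K`. -/
noncomputable def boundaries (K : PreAbstractSimplicialComplex V) (j : ℕ) :
    Submodule F (Finset V → F) :=
  (chains F K (j + 1)).map (boundary F)

/-- The `j`-th simplicial homology of `K` with coefficients in `F`: cycles modulo boundaries. -/
abbrev Homology (K : PreAbstractSimplicialComplex V) (j : ℕ) : Type _ :=
  cycles F K j ⧸ (boundaries F K j).submoduleOf (cycles F K j)

/-- The `j`-th Betti number of `K` with coefficients in `F`. -/
noncomputable def betti (K : PreAbstractSimplicialComplex V) (j : ℕ) : ℕ :=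
  Module.finrank F (Homology F K j)

end Homology

/-! ### Vietoris–Rips and Čech complexes, and their soft versions -/

/-- The Vietoris–Rips complex of the points `x i`: a nonempty set of vertices is a face when the
closed balls of radius `r / 2` around its points intersect pairwise. -/
def rips {E : Type*} [PseudoMetricSpace E] {V : Type*} (x : V → E) (r : ℝ) :
    PreAbstractSimplicialComplex V where
  faces := {σ | σ.Nonempty ∧ ∀ i ∈ σ, ∀ j ∈ σ,
    (Metric.closedBall (x i) (r / 2) ∩ Metric.closedBall (x j) (r / 2)).Nonempty}
  isRelLowerSet_faces := fun _ hσ =>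
    ⟨hσ.1, fun _ hτ hne => ⟨hne, fun i hi j hj => hσ.2 i (hτ hi) j (hτ hj)⟩⟩

/-- The Čech complex of the points `x i`: a nonempty set of vertices is a face when the closed
balls of radius `r / 2` around its points have a common point. -/
def cech {E : Type*} [PseudoMetricSpace E] {V : Type*} (x : V → E) (r : ℝ) :
    PreAbstractSimplicialComplex V where
  faces := {σ | σ.Nonempty ∧ (⋂ i ∈ σ, Metric.closedBall (x i) (r / 2)).Nonempty}
  isRelLowerSet_faces := fun _ hσ =>
    ⟨hσ.1, fun _ hτ hne => ⟨hne, hσ.2.mono (Set.biInter_subset_biInter_left hτ)⟩⟩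

/-- The potential faces of positive dimension on the vertices `0, …, n - 1`. -/
abbrev PosFace (n : ℕ) : Type := {σ : Finset (Fin n) // 2 ≤ σ.card}

/-- The subcomplex of `K` obtained by removing the faces of positive dimension whose coin shows
`false`, together with every face that contains a removed one. -/
def soften {n : ℕ} (K : PreAbstractSimplicialComplex (Fin n)) (c : PosFace n → Bool) :
    PreAbstractSimplicialComplex (Fin n) where
  faces := {σ | σ ∈ K ∧ ∀ τ : PosFace n, τ.1 ⊆ σ → c τ = true}
  isRelLowerSet_faces := fun _ hσ =>
    ⟨(K.isRelLowerSet_faces hσ.1).1, fun _ hτ hne =>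
      ⟨(K.isRelLowerSet_faces hσ.1).2 hτ hne, fun ρ hρ => hσ.2 ρ (hρ.trans hτ)⟩⟩

/-! ### The probability model -/

/-- The law of the data of the model: `n` independent points of `ℝ^d` with density `f`, and,
independently of them, independent coins, one for each potential face of dimension `i ≥ 1`,
showing `true` with probability `p i`. -/
noncomputable def law {d : ℕ} (f : EuclideanSpace ℝ (Fin d) → ℝ) (p : ℕ → unitInterval) (n : ℕ) :
    Measure ((Fin n → EuclideanSpace ℝ (Fin d)) × (PosFace n → Bool)) :=
  (Measure.pi fun _ : Fin n => volume.withDensity fun x => ENNReal.ofReal (f x)).prod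
    (Measure.pi fun σ : PosFace n => bernoulliMeasure true false (p (σ.1.card - 1)))

/-- The random variable `β_k(R(n,r,ρ))`. -/
noncomputable def ripsBetti (F : Type*) [Field F] {d : ℕ} (k n : ℕ) (r : ℝ)
    (ω : (Fin n → EuclideanSpace ℝ (Fin d)) × (PosFace n → Bool)) : ℝ :=
  betti F (soften (rips ω.1 r) ω.2) k

/-- The random variable `β_k(C(n,r,ρ))`. -/
noncomputable def cechBetti (F : Type*) [Field F] {d : ℕ} (k n : ℕ) (r : ℝ)
    (ω : (Fin n → EuclideanSpace ℝ (Fin d)) × (PosFace n → Bool)) : ℝ :=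
  betti F (soften (cech ω.1 r) ω.2) k

end SoftComplex

namespace SoftComplex

/-! The upper bound counts simplices. `betti_le_card` bounds `β_k` by the number of `k`-faces, hence
by the number of `(k+1)`-sets of points with pairwise distances at most `r`. By
`measure_pairwise_dist_le` a given set has this property with probability `O(r^(dk))`, so the mean
is of order `n^(k+1) r^(dk) = n (n r^d)^k = O(n)`. Coins play no role.

The lower bound counts small isolated spheres: `k+2` points whose proper subsets are all faces,
which do not themselves span a face, and which have no edge to any other point. Pairwise disjoint
spheres of this kind give independent homology classes (`card_le_betti`). To produce them, fix a
pattern `z` and look for points near a copy `w + r • z`, with all other points outside a larger ball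
around `w`. Fubini over `w`, Lebesgue differentiation and Fatou give a given `(k+2)`-set probability
at least of order `r^(d(k+1))`; isolation costs only a factor `(1 - O(r^d))^n`, which stays away
from zero (`exists_pos_le_real_isCluster`). The independent coins contribute at least `n^(-ε)`, and
summing over about `n^(k+2)` sets gives `n^(1-ε)`.

The two complexes differ only in how the hole arises. A Rips cluster spans a full simplex whose top
face must be deleted by its coin, whence `1 - p_{k+1}`. For Čech the pattern itself is hollow, which
`exists_isHollow` achieves when `k < d`. -/

lemma sign_add_sign_swap (F : Type*) [Field F] {V : Type*} [LinearOrder V] {σ : Finset V} {u v : V} (hu : u ∈ σ) (hv : v ∈ σ) (huv : u ≠ v) :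
    (-1 : F) ^ (σ.filter fun w => w < v).card *
        (-1) ^ ((σ.erase v).filter fun w => w < u).card +
      (-1) ^ (σ.filter fun w => w < u).card *
        (-1) ^ ((σ.erase u).filter fun w => w < v).card = 0 := by
  wlog h : u < v generalizing u v
  · rw [add_comm]
    exact this hv hu huv.symm (lt_of_le_of_ne (not_lt.1 h) huv.symm)
  have h1 : (σ.erase v).filter (fun w => w < u) = σ.filter fun w => w < u := by
    ext w
    simp only [Finset.mem_filter, Finset.mem_erase]
    refine ⟨fun h => ⟨h.1.2, h.2⟩, fun hw => ⟨⟨(hw.2.trans h).ne, hw.1⟩, hw.2⟩⟩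
  have h2 : ((σ.erase u).filter fun w => w < v).card + 1 = (σ.filter fun w => w < v).card := by
    rw [Finset.filter_erase, Finset.card_erase_add_one]
    exact Finset.mem_filter.2 ⟨hu, h⟩
  rw [h1, ← h2, pow_succ]
  ring

/-! ### Linear algebra: bounding Betti numbers from above and below. -/

section Homology

variable (F : Type*) [Field F] {V : Type*} [Fintype V] [LinearOrder V]

lemma boundary_single (σ : Finset V) (a : F) :
    boundary F (Pi.single σ a) = if 2 ≤ σ.card then
      ∑ v ∈ σ, Pi.single (σ.erase v) (a * (-1 : F) ^ (σ.filter fun u => u < v).card) else 0 := by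
  unfold boundary
  rw [Fintype.linearCombination_apply_single]
  split_ifs
  · rw [Finset.smul_sum]
    refine Finset.sum_congr rfl fun v _ => ?_
    rw [← Pi.single_smul, smul_eq_mul]
  · simp

lemma boundary_apply (c : Finset V → F) (τ : Finset V) :
    boundary F c τ = ∑ σ, if 2 ≤ σ.card then
      ∑ v ∈ σ, if σ.erase v = τ then c σ * (-1 : F) ^ (σ.filter fun u => u < v).card else 0
      else 0 := by
  unfold boundary
  rw [Fintype.linearCombination_apply, Finset.sum_apply]
  refine Finset.sum_congr rfl fun σ _ => ?_
  split_ifs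
  · simp only [Pi.smul_apply, Finset.sum_apply, smul_eq_mul, Finset.mul_sum, Pi.single_apply,
      mul_ite, mul_zero, eq_comm]
  · simp

/-- Deleting `v` then `u` cancels against deleting `u` then `v`, by `sign_add_sign_swap`. -/
lemma boundary_boundary_single (σ : Finset V) (a : F) :
    boundary F (boundary F (Pi.single σ a)) = 0 := by
  rw [boundary_single]
  split_ifs with h
  swap
  · simp
  rw [map_sum]
  -- An edge is a separate case: its boundary consists of vertices, which the unreduced boundary map
  -- kills.
  by_cases h3 : 3 ≤ σ.card
  swap
  · refine Finset.sum_eq_zero fun v hv => ?_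
    rw [boundary_single, if_neg]
    rw [Finset.card_erase_of_mem hv]
    omega
  have hs : ∀ v ∈ σ, boundary F (Pi.single (σ.erase v)
        (a * (-1 : F) ^ (σ.filter fun u => u < v).card)) =
      ∑ u ∈ σ.erase v, Pi.single ((σ.erase v).erase u)
        (a * (-1 : F) ^ (σ.filter fun u => u < v).card *
          (-1) ^ ((σ.erase v).filter fun w => w < u).card) := fun v hv => by
    rw [boundary_single, if_pos]
    rw [Finset.card_erase_of_mem hv]
    omega
  rw [Finset.sum_congr rfl hs, Finset.sum_sigma']
  refine Finset.sum_involution (fun x _ => ⟨x.2, x.1⟩) ?_ ?_ ?_ ?_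
  · rintro ⟨v, u⟩ hx
    simp only [Finset.mem_sigma, Finset.mem_erase] at hx
    dsimp only
    rw [Finset.erase_right_comm (a := u) (b := v), ← Pi.single_add, mul_assoc, mul_assoc,
      ← mul_add, sign_add_sign_swap F hx.2.2 hx.1 hx.2.1, mul_zero, Pi.single_zero]
  · rintro ⟨v, u⟩ hx _ he
    simp only [Finset.mem_sigma, Finset.mem_erase] at hx
    simp only [Sigma.mk.injEq] at he
    exact hx.2.1 he.1
  · rintro ⟨v, u⟩ hx
    simp only [Finset.mem_sigma, Finset.mem_erase] at hx ⊢
    exact ⟨hx.2.2, hx.2.1.symm, hx.1⟩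
  · rintro ⟨v, u⟩ _
    rfl

/-- A cycle is determined by its coefficients on the `k`-faces, and homology is a quotient of the
cycles. -/
lemma betti_le_card {K : PreAbstractSimplicialComplex V} {j : ℕ} {S : Finset (Finset V)}
    (hS : ∀ σ ∈ K, σ.card = j + 1 → σ ∈ S) : betti F K j ≤ S.card := by
  let g : cycles F K j →ₗ[F] (S → F) :=
    LinearMap.pi (fun σ => LinearMap.proj σ.1) ∘ₗ (cycles F K j).subtype
  have hg : Function.Injective g := by
    rw [injective_iff_map_eq_zero]
    intro c hc
    ext σ
    by_contra h
    have h1 := c.2.1 σ h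
    exact h (congrFun hc ⟨σ, hS σ h1.1 h1.2⟩)
  calc betti F K j ≤ Module.finrank F (cycles F K j) := Submodule.finrank_quotient_le _
    _ ≤ Module.finrank F (S → F) := LinearMap.finrank_le_finrank_of_injective hg
    _ = S.card := by simp

/-- A set of vertices all of whose proper nonempty subsets are faces of `K`, which is not itself
a face of `K`, and which is not joined by an edge of `K` to any other vertex. -/
structure IsIsolatedSphere (K : PreAbstractSimplicialComplex V) (I : Finset V) : Prop where
  mem : ∀ τ ⊂ I, τ.Nonempty → τ ∈ K
  notMem : I ∉ K
  isolated : ∀ i ∈ I, ∀ j ∉ I, ({i, j} : Finset V) ∉ K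

variable {F} in
lemma IsIsolatedSphere.boundary_mem_cycles {K : PreAbstractSimplicialComplex V} {I : Finset V}
    (h : IsIsolatedSphere K I) {k : ℕ} (hI : I.card = k + 2) :
    boundary F (Pi.single I 1) ∈ cycles F K k := by
  refine ⟨fun σ hσ => ?_, boundary_boundary_single F I 1⟩
  rw [boundary_single, if_pos (by omega), Finset.sum_apply] at hσ
  obtain ⟨v, hv, hne⟩ := Finset.exists_ne_zero_of_sum_ne_zero hσ
  have : σ = I.erase v := by
    by_contra h0
    exact hne (Pi.single_eq_of_ne h0 _)
  subst this
  have hc := Finset.card_erase_of_mem hv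
  exact ⟨h.mem _ (Finset.erase_ssubset hv) (Finset.card_pos.1 (by omega)), by omega⟩

/-- A face of dimension `k+1` having `I.erase v` as a facet would either be `I`, which is missing,
or have a vertex outside `I`, giving an edge that leaves `I`. So coefficients at such facets are
functionals on homology. -/
lemma IsIsolatedSphere.apply_eq_zero_of_mem_boundaries {K : PreAbstractSimplicialComplex V}
    {I : Finset V} (h : IsIsolatedSphere K I) {k : ℕ} (hI : I.card = k + 2) {v : V}
    {c : Finset V → F} (hc : c ∈ boundaries F K k) : c (I.erase v) = 0 := by
  obtain ⟨b, hb, rfl⟩ := hc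
  rw [boundary_apply]
  refine Finset.sum_eq_zero fun σ _ => ?_
  split_ifs
  swap
  · rfl
  refine Finset.sum_eq_zero fun u hu => ?_
  split_ifs with he
  swap
  · rfl
  by_cases h0 : b σ = 0
  · simp [h0]
  exfalso
  obtain ⟨hσK, hσc⟩ := hb σ h0
  have hcard : 1 ≤ (I.erase v).card := (by omega : 1 ≤ I.card - 1).trans Finset.pred_card_le_card_erase
  obtain ⟨i, hi⟩ := Finset.card_pos.1 hcard
  have hiσ : i ∈ σ := Finset.mem_of_mem_erase (he ▸ hi)
  by_cases hsub : σ ⊆ I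
  · exact h.notMem (Finset.eq_of_subset_of_card_le hsub (by omega) ▸ hσK)
  · obtain ⟨j, hj, hjI⟩ := Finset.not_subset.1 hsub
    refine h.isolated i (Finset.mem_of_mem_erase hi) j hjI ((K.isRelLowerSet_faces hσK).2 ?_ ?_)
    · intro w hw
      rcases Finset.mem_insert.1 hw with rfl | hw
      · exact hiσ
      · exact (Finset.mem_singleton.1 hw) ▸ hj
    · exact ⟨i, Finset.mem_insert_self _ _⟩

/-- Reading off one facet coefficient per sphere gives a map on homology. On the cycles `∂I` its
matrix is diagonal with entries `±1`, because disjoint spheres share no facet; hence it is onto. -/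
lemma card_le_betti {K : PreAbstractSimplicialComplex V} {k : ℕ} {S : Finset (Finset V)}
    (hS : ∀ I ∈ S, I.card = k + 2 ∧ IsIsolatedSphere K I)
    (hd : (S : Set (Finset V)).PairwiseDisjoint id) : S.card ≤ betti F K k := by
  have hne : ∀ I : S, ∃ v, v ∈ I.1 := fun I =>
    Finset.card_pos.1 (by have := (hS I.1 I.2).1; omega)
  choose v hv using hne
  let g : cycles F K k →ₗ[F] (S → F) :=
    LinearMap.pi (fun I => LinearMap.proj (I.1.erase (v I))) ∘ₗ (cycles F K k).subtype
  have hker : (boundaries F K k).submoduleOf (cycles F K k) ≤ LinearMap.ker g := by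
    intro c hc
    rw [LinearMap.mem_ker]
    ext I
    exact (hS I.1 I.2).2.apply_eq_zero_of_mem_boundaries F (hS I.1 I.2).1 hc
  let e : S → F := fun I => (-1 : F) ^ (I.1.filter fun u => u < v I).card
  have hz : ∀ I : S, g ⟨_, (hS I.1 I.2).2.boundary_mem_cycles (F := F) (hS I.1 I.2).1⟩ =
      Pi.single I (e I) := by
    intro I
    ext J
    change boundary F (Pi.single I.1 1) (J.1.erase (v J)) = _
    have hI := (hS I.1 I.2).1
    have hJ := (hS J.1 J.2).1
    rw [boundary_single, if_pos (by omega), Finset.sum_apply]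
    by_cases hIJ : J = I
    · subst hIJ
      rw [Finset.sum_eq_single (v J)]
      · simp [e]
      · intro u hu huv
        refine Pi.single_eq_of_ne (fun h => huv ?_) _
        by_contra hne
        exact (Finset.mem_erase.1 (h ▸ Finset.mem_erase.2 ⟨Ne.symm (Ne.symm hne), hu⟩ :
          u ∈ J.1.erase u)).1 rfl
      · exact fun h => absurd (hv J) h
    · rw [Pi.single_eq_of_ne hIJ]
      refine Finset.sum_eq_zero fun u hu => Pi.single_eq_of_ne (fun h => hIJ ?_) _
      by_contra hne
      have hdis : Disjoint J.1 I.1 := hd J.2 I.2 fun h => hne (Subtype.ext h)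
      have hcard : 1 ≤ (J.1.erase (v J)).card :=
        (by omega : 1 ≤ J.1.card - 1).trans Finset.pred_card_le_card_erase
      obtain ⟨i, hi⟩ := Finset.card_pos.1 hcard
      exact Finset.disjoint_left.1 hdis (Finset.mem_of_mem_erase hi)
        (Finset.mem_of_mem_erase (h ▸ hi))
  have hsurj : Function.Surjective g := by
    rw [← LinearMap.range_eq_top, ← top_le_iff, ← (Pi.basisFun F S).span_eq, Submodule.span_le]
    rintro _ ⟨I, rfl⟩
    refine ⟨(e I)⁻¹ • ⟨_, (hS I.1 I.2).2.boundary_mem_cycles (F := F) (hS I.1 I.2).1⟩, ?_⟩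
    rw [map_smul, hz, ← Pi.single_smul, smul_eq_mul, inv_mul_cancel₀, Pi.basisFun_apply]
    simp [e]
  have hsurj' : Function.Surjective (Submodule.liftQ _ g hker) := fun y => by
    obtain ⟨c, hc⟩ := hsurj y
    exact ⟨Submodule.Quotient.mk c, hc⟩
  calc S.card = Module.finrank F (S → F) := by simp
    _ ≤ betti F K k := LinearMap.finrank_le_finrank_of_surjective hsurj'

end Homology

/-! ### Measurability of faces and integrability of Betti numbers. -/

section Measurability

/-- Betti numbers of a random complex are measurable as soon as each face is a random event. -/
lemma measurable_betti (F : Type*) [Field F] {V : Type*} [Fintype V] [LinearOrder V]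
    {Ω : Type*} [MeasurableSpace Ω] {K : Ω → PreAbstractSimplicialComplex V}
    (hK : ∀ σ, MeasurableSet {ω | σ ∈ K ω}) (j : ℕ) :
    Measurable fun ω => (betti F (K ω) j : ℝ) := by
  classical
  -- The Betti number factors through the face set, an element of a finite type; the default `0` is
  -- never reached.
  let g : Set (Finset V) → ℝ := fun s =>
    if h : IsRelLowerSet s Finset.Nonempty then (betti F ⟨s, h⟩ j : ℝ) else 0
  have hg : (fun ω => (betti F (K ω) j : ℝ)) = g ∘ fun ω => (K ω).faces := by
    ext ω
    simp only [g, Function.comp_apply, dif_pos (K ω).isRelLowerSet_faces]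
  rw [hg]
  refine Measurable.comp (measurable_of_finite g) ?_
  rw [measurable_set_iff]
  intro σ
  exact measurableSet_setOfPred.1 (hK σ)

lemma integrable_betti (F : Type*) [Field F] {V : Type*} [Fintype V] [LinearOrder V]
    {Ω : Type*} [MeasurableSpace Ω] {K : Ω → PreAbstractSimplicialComplex V}
    (hK : ∀ σ, MeasurableSet {ω | σ ∈ K ω}) (j : ℕ) (P : Measure Ω) [IsFiniteMeasure P] :
    Integrable (fun ω => (betti F (K ω) j : ℝ)) P := by
  refine Integrable.of_bound (measurable_betti F hK j).aestronglyMeasurable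
    (Finset.univ : Finset (Finset V)).card (Eventually.of_forall fun ω => ?_)
  rw [Real.norm_of_nonneg (Nat.cast_nonneg _)]
  exact_mod_cast betti_le_card F fun σ _ _ => Finset.mem_univ σ

lemma mem_rips_iff {E : Type*} [NormedAddCommGroup E] [NormedSpace ℝ E] {V : Type*} {x : V → E}
    {r : ℝ} {σ : Finset V} :
    σ ∈ rips x r ↔ σ.Nonempty ∧ ∀ i ∈ σ, ∀ j ∈ σ, dist (x i) (x j) ≤ r := by
  refine and_congr_right fun _ => forall₂_congr fun i _ => forall₂_congr fun j _ => ?_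
  constructor
  · intro h
    simpa using Metric.dist_le_add_of_nonempty_closedBall_inter_closedBall h
  · intro h
    refine ⟨midpoint ℝ (x i) (x j), ?_, ?_⟩
    · rw [Metric.mem_closedBall, dist_midpoint_left, Real.norm_of_nonneg (by norm_num)]
      linarith
    · rw [Metric.mem_closedBall, dist_midpoint_right, Real.norm_of_nonneg (by norm_num)]
      linarith

lemma mem_cech_iff {E : Type*} [PseudoMetricSpace E] {V : Type*} {x : V → E} {r : ℝ}
    {σ : Finset V} :
    σ ∈ cech x r ↔ σ.Nonempty ∧ ∃ y, ∀ i ∈ σ, dist (x i) y ≤ r / 2 := by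
  refine and_congr_right fun _ => exists_congr fun y => ?_
  simp [dist_comm]

lemma cech_le_rips {E : Type*} [NormedAddCommGroup E] [NormedSpace ℝ E] {V : Type*} {x : V → E}
    {r : ℝ} {σ : Finset V} (h : σ ∈ cech x r) : σ ∈ rips x r := by
  obtain ⟨hne, y, hy⟩ := mem_cech_iff.1 h
  refine mem_rips_iff.2 ⟨hne, fun i hi j hj => ?_⟩
  have := dist_triangle_right (x i) (x j) y
  linarith [hy i hi, hy j hj]

variable {E : Type*} [NormedAddCommGroup E] [NormedSpace ℝ E] [FiniteDimensional ℝ E]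
  [MeasurableSpace E] [BorelSpace E] {V : Type*} [Fintype V]

lemma measurableSet_mem_rips (σ : Finset V) (r : ℝ) :
    MeasurableSet {x : V → E | σ ∈ rips x r} := by
  simp only [mem_rips_iff]
  by_cases h : σ.Nonempty
  · simp only [h, true_and]
    refine IsClosed.measurableSet ?_
    simp only [Set.ofPred_forall]
    exact isClosed_iInter fun i => isClosed_iInter fun _ => isClosed_iInter fun j =>
      isClosed_iInter fun _ => isClosed_le (by fun_prop) continuous_const
  · simp [h]

/-- Membership is a projection of a closed set. In finite dimension that set is σ-compact, so its
image is a countable union of compact sets. -/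
lemma measurableSet_mem_cech (σ : Finset V) (r : ℝ) :
    MeasurableSet {x : V → E | σ ∈ cech x r} := by
  simp only [mem_cech_iff]
  by_cases h : σ.Nonempty
  · simp only [h, true_and]
    have hc : IsClosed {q : (V → E) × E | ∀ i ∈ σ, dist (q.1 i) q.2 ≤ r / 2} := by
      simp only [Set.ofPred_forall]
      exact isClosed_iInter fun i => isClosed_iInter fun _ =>
        isClosed_le (by fun_prop) continuous_const
    obtain ⟨A, hA, hAU⟩ :=
      (isSigmaCompact_univ.of_isClosed_subset hc (Set.subset_univ _)).image continuous_fst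
    have : {x : V → E | ∃ y, ∀ i ∈ σ, dist (x i) y ≤ r / 2} = ⋃ i, A i := by
      rw [hAU]
      ext x
      simp
    rw [this]
    exact MeasurableSet.iUnion fun i => (hA i).measurableSet
  · simp [h]

lemma measurableSet_mem_soften {n : ℕ} {Ω : Type*} [MeasurableSpace Ω]
    {K : Ω → PreAbstractSimplicialComplex (Fin n)} (hK : ∀ σ, MeasurableSet {ω | σ ∈ K ω})
    (σ : Finset (Fin n)) :
    MeasurableSet {ω : Ω × (PosFace n → Bool) | σ ∈ soften (K ω.1) ω.2} := by
  have : {ω : Ω × (PosFace n → Bool) | σ ∈ soften (K ω.1) ω.2} =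
      {ω | σ ∈ K ω} ×ˢ {c | ∀ τ : PosFace n, τ.1 ⊆ σ → c τ = true} := rfl
  rw [this]
  exact (hK σ).prod (Set.toFinite _).measurableSet

end Measurability

/-! ### Clusters: disjointness, isolation and the faces they span. -/

section Geometry

/-- The points `x i`, `i ∈ I`, are close to the vertices of the copy `w + r • z` of a
configuration `z`, and all other points are far away from `w`. -/
def IsCluster {E : Type*} [NormedAddCommGroup E] [NormedSpace ℝ E] {V : Type*} {m : ℕ}
    (z : Fin m → E) (η R r : ℝ) (I : Finset V) (x : V → E) : Prop :=
  ∃ (e : Fin m ≃ I) (w : E), (∀ a, x (e a) ∈ Metric.ball (w + r • z a) (r * η)) ∧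
    ∀ j ∉ I, x j ∉ Metric.closedBall w (r * R)

variable {E : Type*} [NormedAddCommGroup E] [NormedSpace ℝ E] {V : Type*} {m : ℕ}
  {z : Fin m → E} {η R ρ r : ℝ} {x : V → E}

lemma dist_center_lt {w y : E} {a : Fin m} (hr : 0 < r) (hρ : ∀ a, ‖z a‖ + η ≤ ρ)
    (h : y ∈ Metric.ball (w + r • z a) (r * η)) : dist y w < r * ρ := by
  rw [Metric.mem_ball] at h
  have h1 := dist_triangle y (w + r • z a) w
  have h2 : dist (w + r • z a) w = r * ‖z a‖ := by
    rw [dist_eq_norm, add_sub_cancel_left, norm_smul, Real.norm_of_nonneg hr.le]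
  have h3 := mul_le_mul_of_nonneg_left (hρ a) hr.le
  rw [mul_add] at h3
  linarith

/-- If the clusters shared a point, a point of `J` outside `I` would lie within `3 * r * ρ` of the
centre of `I`, inside the ball that must be empty of it. -/
lemma IsCluster.disjoint {I J : Finset V} (hr : 0 < r) (hρ : ∀ a, ‖z a‖ + η ≤ ρ)
    (hR : 3 * ρ ≤ R) (hI : IsCluster z η R r I x) (hJ : IsCluster z η R r J x) (hne : I ≠ J) :
    Disjoint I J := by
  have hIc : I.card = m := by
    obtain ⟨e, -⟩ := hI
    simpa using (Fintype.card_congr e).symm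
  have hJc : J.card = m := by
    obtain ⟨e, -⟩ := hJ
    simpa using (Fintype.card_congr e).symm
  rw [Finset.disjoint_left]
  intro i hiI hiJ
  obtain ⟨j, hjJ, hjI⟩ : ∃ j ∈ J, j ∉ I := Finset.not_subset.1 fun hsub =>
    hne (Finset.eq_of_subset_of_card_le hsub (by omega)).symm
  obtain ⟨e, w, h1, h2⟩ := hI
  obtain ⟨e', w', h1', -⟩ := hJ
  apply h2 j hjI
  have a1 := dist_center_lt hr hρ (h1 (e.symm ⟨i, hiI⟩))
  have a2 := dist_center_lt hr hρ (h1' (e'.symm ⟨i, hiJ⟩))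
  have a3 := dist_center_lt hr hρ (h1' (e'.symm ⟨j, hjJ⟩))
  simp only [Equiv.apply_symm_apply] at a1 a2 a3
  rw [Metric.mem_closedBall]
  have b1 := dist_triangle (x j) w' w
  have b2 := dist_triangle w' (x i) w
  rw [dist_comm w' (x i)] at b2
  have b3 := mul_le_mul_of_nonneg_left hR hr.le
  linarith

lemma IsCluster.lt_dist {I : Finset V} (hr : 0 < r) (hρ : ∀ a, ‖z a‖ + η ≤ ρ)
    (hR : ρ + 1 ≤ R) (hI : IsCluster z η R r I x) {i j : V} (hi : i ∈ I) (hj : j ∉ I) :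
    r < dist (x i) (x j) := by
  obtain ⟨e, w, h1, h2⟩ := hI
  have a1 := dist_center_lt hr hρ (h1 (e.symm ⟨i, hi⟩))
  have a2 := h2 j hj
  simp only [Equiv.apply_symm_apply] at a1
  rw [Metric.mem_closedBall, not_le] at a2
  have b1 := dist_triangle (x j) (x i) w
  rw [dist_comm (x j) (x i)] at b1
  have b3 := mul_le_mul_of_nonneg_left hR hr.le
  linarith

/-- Openness yields measurability although the centre ranges over an uncountable set; hence the open
small balls and the closed excluded ball. -/
lemma isOpen_isCluster [Finite V] (I : Finset V) :
    IsOpen {x : V → E | IsCluster z η R r I x} := by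
  simp only [IsCluster, Set.ofPred_exists, Set.ofPred_and, Set.ofPred_forall]
  refine isOpen_iUnion fun e => isOpen_iUnion fun w => IsOpen.inter ?_ ?_
  · exact isOpen_iInter_of_finite fun a =>
      Metric.isOpen_ball.preimage (continuous_apply (e a : V))
  · refine isOpen_iInter_of_finite fun j => isOpen_iInter_of_finite fun _ => ?_
    have h : IsOpen (Metric.closedBall w (r * R))ᶜ := Metric.isClosed_closedBall.isOpen_compl
    exact h.preimage (continuous_apply (A := fun _ : V => E) j)

/-- Points close to a common centre span a simplex of the Rips complex. -/
lemma IsCluster.mem_rips {I τ : Finset V} (hI : IsCluster (fun _ : Fin m => (0 : E)) (1 / 2) R r I x)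
    (hτ : τ ⊆ I) (hne : τ.Nonempty) : τ ∈ rips x r := by
  obtain ⟨e, w, h1, -⟩ := hI
  have h : ∀ i ∈ τ, dist (x i) w < r * (1 / 2) := fun i hi => by
    have := h1 (e.symm ⟨i, hτ hi⟩)
    simpa using this
  refine mem_rips_iff.2 ⟨hne, fun i hi j hj => ?_⟩
  have := dist_triangle_right (x i) (x j) w
  linarith [h i hi, h j hj]

/-- A configuration of points whose small perturbations have the boundary of a simplex as their
Čech complex at scale one. -/
def IsHollow (z : Fin m → E) (η : ℝ) : Prop :=
  (∀ a, ∃ y, ∀ b ≠ a, dist (z b) y + η ≤ 1 / 2) ∧ ∀ y, ∃ a, 1 / 2 + η ≤ dist (z a) y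

lemma IsCluster.mem_cech {I τ : Finset V} (hr : 0 < r) (hz : IsHollow z η)
    (hI : IsCluster z η R r I x) (hτ : τ ⊂ I) (hne : τ.Nonempty) : τ ∈ cech x r := by
  obtain ⟨e, w, h1, -⟩ := hI
  obtain ⟨i, hi, hiτ⟩ := Finset.exists_of_ssubset hτ
  -- The common point is the rescaled witness for an omitted vertex of the pattern; the margin `η`
  -- absorbs the perturbation.
  obtain ⟨y, hy⟩ := hz.1 (e.symm ⟨i, hi⟩)
  refine mem_cech_iff.2 ⟨hne, w + r • y, fun j hj => ?_⟩
  have hb := hy (e.symm ⟨j, hτ.1 hj⟩) fun h => hiτ (by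
    have : j = i := congrArg Subtype.val (e.symm.injective h)
    rwa [← this])
  have h2 := h1 (e.symm ⟨j, hτ.1 hj⟩)
  simp only [Equiv.apply_symm_apply, Metric.mem_ball] at h2
  generalize e.symm ⟨j, hτ.1 hj⟩ = b at *
  have h3 := dist_triangle (x j) (w + r • z b) (w + r • y)
  rw [dist_add_left, dist_smul₀, Real.norm_of_nonneg hr.le] at h3
  have := mul_le_mul_of_nonneg_left hb hr.le
  linarith

lemma IsCluster.notMem_cech {I : Finset V} (hr : 0 < r) (hz : IsHollow z η)
    (hI : IsCluster z η R r I x) : I ∉ cech x r := by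
  obtain ⟨e, w, h1, -⟩ := hI
  rw [mem_cech_iff]
  rintro ⟨-, y, hy⟩
  -- The alleged common point is carried back to the scale of the pattern.
  obtain ⟨a, ha⟩ := hz.2 (r⁻¹ • (y - w))
  have h2 := hy (e a) (e a).2
  have h3 := h1 a
  rw [Metric.mem_ball] at h3
  have h4 := dist_triangle_left (w + r • z a) y (x (e a))
  have h5 : dist (w + r • z a) y = r * dist (z a) (r⁻¹ • (y - w)) := by
    have : y = w + r • r⁻¹ • (y - w) := by rw [smul_inv_smul₀ hr.ne']; abel
    conv_lhs => rw [this]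
    rw [dist_add_left, dist_smul₀, Real.norm_of_nonneg hr.le]
  have h6 := mul_le_mul_of_nonneg_left ha hr.le
  linarith

end Geometry

/-! ### Construction of hollow configurations. -/

section Hollow

/-- Points `u a` of the unit sphere with the origin as a positive combination, such that each open
half space of a suitable family contains all but one of them, can be rescaled to a hollow
configuration. -/
lemma exists_isHollow_of_unit {E : Type*} [NormedAddCommGroup E] [InnerProductSpace ℝ E] {m : ℕ}
    (u : Fin m → E) (hu : ∀ a, ‖u a‖ = 1) (c : Fin m → ℝ) (hc : ∀ a, 0 < c a) (hm : 0 < m)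
    (h0 : ∑ a, c a • u a = 0) (v : Fin m → E) (hv : ∀ a, ∀ b ≠ a, 0 < inner ℝ (v a) (u b)) :
    ∃ (z : Fin m → E) (η : ℝ), 0 < η ∧ IsHollow z η := by
  -- As `∑ c a • u a = 0`, the weighted mean of the squared distances to `y` is `1 + ‖y‖²`, so they
  -- cannot all be below `1`.
  have h1 : ∀ y, ∃ a, 1 ≤ dist (u a) y := by
    intro y
    by_contra! h
    have h2 : ∑ a, c a * dist (u a) y ^ 2 < ∑ a, c a := by
      refine Finset.sum_lt_sum_of_nonempty ⟨⟨0, hm⟩, Finset.mem_univ _⟩ fun a _ => ?_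
      have : dist (u a) y ^ 2 < 1 := by
        have := dist_nonneg (x := u a) (y := y)
        nlinarith [h a]
      nlinarith [hc a]
    have h3 : ∑ a, c a * dist (u a) y ^ 2 =
        (∑ a, c a) * (1 + ‖y‖ ^ 2) - 2 * inner ℝ (∑ a, c a • u a) y := by
      rw [sum_inner, Finset.sum_mul, Finset.mul_sum, ← Finset.sum_sub_distrib]
      refine Finset.sum_congr rfl fun a _ => ?_
      rw [dist_eq_norm, norm_sub_sq_real, hu, real_inner_smul_left]
      ring
    rw [h3, h0, inner_zero_left] at h2
    have : 0 ≤ ∑ a, c a := Finset.sum_nonneg fun a _ => (hc a).le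
    nlinarith [sq_nonneg ‖y‖]
  -- A short move from the origin along `v a` brings every `u b` with `b ≠ a` closer than `1`, to
  -- first order by `2 * t * inner (v a) (u b)` in the squared distance.
  have h2 : ∀ a, ∃ (q : ℝ) (y : E), q < 1 ∧ 0 ≤ q ∧ ∀ b ≠ a, dist (u b) y ≤ q := by
    intro a
    have hb : ∀ b, ∀ᶠ t in nhdsWithin (0 : ℝ) (Set.Ioi 0), b ≠ a → dist (u b) (t • v a) < 1 := by
      intro b
      have hlim : ∀ᶠ t in nhdsWithin (0 : ℝ) (Set.Ioi 0), b ≠ a →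
          t * ‖v a‖ ^ 2 < 2 * inner ℝ (v a) (u b) := by
        by_cases hba : b = a
        · simp [hba]
        have : Tendsto (fun t : ℝ => t * ‖v a‖ ^ 2) (nhdsWithin (0 : ℝ) (Set.Ioi 0)) (nhds 0) := by
          have : Continuous fun t : ℝ => t * ‖v a‖ ^ 2 := by fun_prop
          simpa using (this.tendsto 0).mono_left nhdsWithin_le_nhds
        filter_upwards [this.eventually_lt_const (mul_pos two_pos (hv a b hba))] with t ht _ using ht
      filter_upwards [hlim, self_mem_nhdsWithin] with t ht htpos hba
      have ht0 : 0 < t := htpos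
      have : dist (u b) (t • v a) ^ 2 < 1 := by
        rw [dist_eq_norm, norm_sub_sq_real, hu, real_inner_smul_right, norm_smul,
          Real.norm_of_nonneg ht0.le, real_inner_comm]
        nlinarith [mul_lt_mul_of_pos_left (ht hba) ht0]
      exact (sq_lt_one_iff₀ dist_nonneg).1 this
    obtain ⟨t, ht⟩ := (eventually_all.2 hb).exists
    by_cases hne : (Finset.univ.filter fun b => b ≠ a).Nonempty
    · obtain ⟨b, hb, hmax⟩ := Finset.exists_max_image _ (fun b => dist (u b) (t • v a)) hne
      refine ⟨dist (u b) (t • v a), t • v a, ht b (Finset.mem_filter.1 hb).2, dist_nonneg,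
        fun b' hb' => hmax b' (by simpa using hb')⟩
    · refine ⟨0, 0, by norm_num, le_rfl, fun b hb => (hne ⟨b, by simpa using hb⟩).elim⟩
  choose q y hq hq0 hy using h2
  obtain ⟨a₀, -, ha₀⟩ := Finset.exists_max_image Finset.univ q ⟨⟨0, hm⟩, Finset.mem_univ _⟩
  set Q := q a₀
  have hQ1 : Q < 1 := hq a₀
  have hQ0 : 0 ≤ Q := hq0 a₀
  -- This scale puts `t * Q` and `t` symmetrically about `1 / 2`, so both margins can be `t - 1 /
  -- 2`.
  set t : ℝ := 1 / (1 + Q)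
  have ht0 : 0 < t := by positivity
  have htQ : t + t * Q = 1 := by simp only [t]; field_simp
  have ht : 1 / 2 < t := by nlinarith
  refine ⟨fun a => t • u a, t - 1 / 2, by linarith, fun a => ⟨t • y a, fun b hb => ?_⟩,
    fun w => ?_⟩
  · rw [dist_smul₀, Real.norm_of_nonneg ht0.le]
    have := mul_le_mul_of_nonneg_left ((hy a b hb).trans (ha₀ a (Finset.mem_univ a))) ht0.le
    linarith
  · obtain ⟨a, ha⟩ := h1 (t⁻¹ • w)
    refine ⟨a, ?_⟩
    have : w = t • t⁻¹ • w := (smul_inv_smul₀ ht0.ne' w).symm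
    rw [this, dist_smul₀, Real.norm_of_nonneg ht0.le]
    nlinarith

/-- The first `k + 1` unit vectors together with the direction opposite to their sum are the
vertices of a simplex containing its circumcentre in its interior. -/
lemma exists_isHollow {d k : ℕ} (hk : k < d) :
    ∃ (z : Fin (k + 2) → EuclideanSpace ℝ (Fin d)) (η : ℝ), 0 < η ∧ IsHollow z η := by
  have horth := ((EuclideanSpace.basisFun (Fin d) ℝ).orthonormal.comp (Fin.castLE hk)
    (Fin.castLE_injective hk))
  set e : Fin (k + 1) → EuclideanSpace ℝ (Fin d) :=
    EuclideanSpace.basisFun (Fin d) ℝ ∘ Fin.castLE hk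
  have hee : ∀ i j, inner ℝ (e i) (e j) = if i = j then (1 : ℝ) else 0 :=
    orthonormal_iff_ite.1 horth
  set s := ∑ i, e i
  have hse : ∀ i, inner ℝ s (e i) = (1 : ℝ) := fun i => by simp [s, sum_inner, hee]
  have hss : inner ℝ s s = (k + 1 : ℝ) := by
    conv_lhs => enter [3]; rw [show s = ∑ i, e i from rfl]
    simp [inner_sum, hse]
  set b : ℝ := (√(k + 1))⁻¹
  have hb : 0 < b := by positivity
  have hnorm : ‖s‖ = √(k + 1) := by rw [norm_eq_sqrt_real_inner, hss]
  -- The weight `b⁻¹` makes the last vertex cancel `s`. The factor `k + 2` exceeds `‖s‖² = k + 1`,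
  -- so `s - (k + 2) • e i` has positive inner product with `-(b • s)`, while its product with `e
  -- j`, `j ≠ i`, is `1`.
  refine exists_isHollow_of_unit (Fin.snoc e (-(b • s))) ?_ (Fin.snoc (fun _ => 1) b⁻¹) ?_
    (by omega) ?_ (Fin.snoc (fun i => s - (k + 2 : ℝ) • e i) s) ?_
  · refine Fin.lastCases ?_ fun i => ?_
    · rw [Fin.snoc_last, norm_neg, norm_smul, hnorm, Real.norm_of_nonneg hb.le]
      exact inv_mul_cancel₀ (by positivity)
    · rw [Fin.snoc_castSucc]
      exact horth.1 i
  · refine Fin.lastCases ?_ fun i => ?_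
    · simpa using hb
    · simp
  · rw [Fin.sum_univ_castSucc]
    simp only [Fin.snoc_castSucc, Fin.snoc_last, one_smul, smul_neg, smul_smul,
      inv_mul_cancel₀ hb.ne']
    simp [s]
  · refine Fin.lastCases ?_ fun i => ?_
    · refine Fin.lastCases (fun h => (h rfl).elim) fun j _ => ?_
      simp [hse]
    · refine Fin.lastCases (fun _ => ?_) fun j hj => ?_
      · rw [Fin.snoc_last, Fin.snoc_castSucc, inner_neg_right, real_inner_smul_right, inner_sub_left,
          hss, real_inner_smul_left, real_inner_comm, hse]
        nlinarith
      · have hij : i ≠ j := fun h => hj (h ▸ rfl)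
        rw [Fin.snoc_castSucc, Fin.snoc_castSucc, inner_sub_left, hse, real_inner_smul_left, hee,
          if_neg hij]
        norm_num

end Hollow

/-! ### Scaling of ball volumes. -/

section Volume

variable {d : ℕ}

lemma volume_closedBall_eq (w : EuclideanSpace ℝ (Fin d)) {s : ℝ} (hs : 0 ≤ s) :
    volume (Metric.closedBall w s) =
      ENNReal.ofReal (s ^ d) * volume (Metric.ball (0 : EuclideanSpace ℝ (Fin d)) 1) := by
  rw [Measure.addHaar_closedBall _ _ hs, finrank_euclideanSpace_fin]

lemma volume_ball_eq (w : EuclideanSpace ℝ (Fin d)) {s : ℝ} (hs : 0 < s) :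
    volume (Metric.ball w s) =
      ENNReal.ofReal (s ^ d) * volume (Metric.ball (0 : EuclideanSpace ℝ (Fin d)) 1) := by
  rw [Measure.addHaar_ball_of_pos _ _ hs, finrank_euclideanSpace_fin]

lemma volume_unitBall_ne_zero :
    volume (Metric.ball (0 : EuclideanSpace ℝ (Fin d)) 1) ≠ 0 :=
  (Metric.measure_ball_pos _ _ one_pos).ne'

lemma volume_unitBall_ne_top :
    volume (Metric.ball (0 : EuclideanSpace ℝ (Fin d)) 1) ≠ ⊤ := measure_ball_lt_top.ne

end Volume

/-- The two ways of computing a mean of the volume of a random set. -/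
lemma lintegral_measure_comm {X Y : Type*} [MeasurableSpace X] [MeasurableSpace Y]
    (μ : Measure X) (ν : Measure Y) [SFinite μ] [SFinite ν] {S : X → Y → Prop}
    (hS : MeasurableSet {q : X × Y | S q.1 q.2}) :
    ∫⁻ x, ν {y | S x y} ∂μ = ∫⁻ y, μ {x | S x y} ∂ν :=
  (Measure.prod_apply hS).symm.trans (Measure.prod_apply_symm hS)

/-! ### Upper bound for the probability that given points are close together. -/

section Upper

variable {d : ℕ} {μ : Measure (EuclideanSpace ℝ (Fin d))} [IsProbabilityMeasure μ]
  {B : ENNReal}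

omit [IsProbabilityMeasure μ] in
lemma measure_closedBall_le (hμ : ∀ s, μ s ≤ B * volume s) (w : EuclideanSpace ℝ (Fin d)) {s : ℝ}
    (hs : 0 ≤ s) : μ (Metric.closedBall w s) ≤
      B * (ENNReal.ofReal (s ^ d) * volume (Metric.ball (0 : EuclideanSpace ℝ (Fin d)) 1)) :=
  volume_closedBall_eq w hs ▸ hμ _

/-- The probability that `k + 1` given points are pairwise at distance at most `r` is
`O(r ^ (d * k))`. -/
lemma measure_pairwise_dist_le (hB : B ≠ ⊤) (hμ : ∀ s, μ s ≤ B * volume s) {V : Type*} [Fintype V] {k : ℕ}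
    {σ : Finset V} (hσ : σ.card = k + 1) {r : ℝ} (hr : 0 < r) :
    Measure.pi (fun _ : V => μ) {x | ∀ i ∈ σ, ∀ j ∈ σ, dist (x i) (x j) ≤ r} ≤
      ENNReal.ofReal (2 ^ d) *
        (B * (ENNReal.ofReal ((2 * r) ^ d) *
          volume (Metric.ball (0 : EuclideanSpace ℝ (Fin d)) 1))) ^ k := by
  classical
  set D := volume (Metric.ball (0 : EuclideanSpace ℝ (Fin d)) 1)
  set P := Measure.pi (fun _ : V => μ)
  set A : Set (V → EuclideanSpace ℝ (Fin d)) := {x | ∀ i ∈ σ, ∀ j ∈ σ, dist (x i) (x j) ≤ r}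
  have h2r : 0 ≤ 2 * r := by positivity
  obtain ⟨i₀, hi₀⟩ := Finset.card_pos.1 (by omega : 0 < σ.card)
  have hA : MeasurableSet A := by
    refine IsClosed.measurableSet ?_
    simp only [A, Set.ofPred_forall]
    exact isClosed_iInter fun i => isClosed_iInter fun _ => isClosed_iInter fun j =>
      isClosed_iInter fun _ => isClosed_le (by fun_prop) continuous_const
  have hS : MeasurableSet {q : EuclideanSpace ℝ (Fin d) × (V → EuclideanSpace ℝ (Fin d)) |
      ∀ i ∈ σ, q.2 i ∈ Metric.closedBall q.1 (2 * r)} := by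
    refine IsClosed.measurableSet ?_
    simp only [Set.ofPred_forall, Metric.mem_closedBall]
    exact isClosed_iInter fun i => isClosed_iInter fun _ =>
      isClosed_le (by fun_prop) continuous_const
  have hS1 : MeasurableSet {q : EuclideanSpace ℝ (Fin d) × EuclideanSpace ℝ (Fin d) |
      q.2 ∈ Metric.closedBall q.1 (2 * r)} := by
    refine IsClosed.measurableSet ?_
    simp only [Metric.mem_closedBall]
    exact isClosed_le (by fun_prop) continuous_const
  have hw : ∀ w, P {x | ∀ i ∈ σ, x i ∈ Metric.closedBall w (2 * r)} =
      μ (Metric.closedBall w (2 * r)) ^ (k + 1) := by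
    intro w
    have : {x : V → EuclideanSpace ℝ (Fin d) | ∀ i ∈ σ, x i ∈ Metric.closedBall w (2 * r)} =
        Set.pi Set.univ fun i => if i ∈ σ then Metric.closedBall w (2 * r) else Set.univ := by
      ext x
      simp only [Set.mem_ofPred_eq, Set.mem_pi, Set.mem_univ, true_imp_iff]
      refine forall_congr' fun i => ?_
      by_cases hi : i ∈ σ <;> simp [hi]
    rw [this, Measure.pi_pi]
    simp only [apply_ite μ, measure_univ]
    rw [Finset.prod_ite_mem, Finset.univ_inter, Finset.prod_const, hσ]
  -- An auxiliary centre `w` decouples the points: on `A`, every `w` within `r` of `x i₀` has all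
  -- the points within `2 * r`. Integrating first over `x` then factorises.
  have h1 : P A * (ENNReal.ofReal (r ^ d) * D) ≤
      ∫⁻ x, volume {w | ∀ i ∈ σ, x i ∈ Metric.closedBall w (2 * r)} ∂P := by
    rw [mul_comm, ← setLIntegral_const]
    refine (setLIntegral_mono' hA fun x hx => ?_).trans (setLIntegral_le_lintegral A _)
    rw [← volume_closedBall_eq (x i₀) hr.le]
    refine measure_mono fun w hw i hi => ?_
    rw [Metric.mem_closedBall] at hw ⊢
    have := dist_triangle (x i) (x i₀) w
    rw [dist_comm w] at hw
    linarith [hx i hi i₀ hi₀]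
  -- One of the `k + 1` factors is integrated exactly, keeping the integral over `w` finite; the
  -- density bound serves for the other `k`.
  have h2 : ∫⁻ w, μ (Metric.closedBall w (2 * r)) =
      ENNReal.ofReal ((2 * r) ^ d) * D := by
    have := lintegral_measure_comm (S := fun w y => y ∈ Metric.closedBall w (2 * r)) volume μ hS1
    have he : ∀ y, {w : EuclideanSpace ℝ (Fin d) | y ∈ Metric.closedBall w (2 * r)} =
        Metric.closedBall y (2 * r) := fun y => by
      ext w
      rw [Set.mem_ofPred_eq, Metric.mem_closedBall, Metric.mem_closedBall, dist_comm]
    simp only [he, volume_closedBall_eq _ h2r, lintegral_const, measure_univ, mul_one] at this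
    exact this
  set c := B * (ENNReal.ofReal ((2 * r) ^ d) * D)
  have h3 : P A * (ENNReal.ofReal (r ^ d) * D) ≤
      c ^ k * (ENNReal.ofReal ((2 * r) ^ d) * D) := by
    refine h1.trans ?_
    rw [← lintegral_measure_comm volume P hS]
    simp only [hw]
    rw [← h2, ← lintegral_const_mul']
    · refine lintegral_mono fun w => ?_
      rw [pow_succ]
      gcongr
      exact measure_closedBall_le hμ w h2r
    · exact ENNReal.pow_ne_top (ENNReal.mul_ne_top hB
        (ENNReal.mul_ne_top ENNReal.ofReal_ne_top volume_unitBall_ne_top))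
  generalize c ^ k = c' at h3 ⊢
  rw [mul_pow, ENNReal.ofReal_mul (by positivity), mul_assoc, ← mul_assoc c', mul_comm c'] at h3
  refine (ENNReal.mul_le_mul_iff_left ?_ ?_).1 h3
  · exact mul_ne_zero (by simpa using pow_pos hr d) volume_unitBall_ne_zero
  · exact ENNReal.mul_ne_top ENNReal.ofReal_ne_top volume_unitBall_ne_top

end Upper

/-! ### Lower bound for the probability of a cluster. -/

section Lower

variable {d m : ℕ}

lemma measurable_measure_closedBall {μ : Measure (EuclideanSpace ℝ (Fin d))} [SFinite μ]
    (v : EuclideanSpace ℝ (Fin d)) (s : ℝ) : Measurable fun w => μ (Metric.closedBall (w + v) s) := by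
  have : MeasurableSet {q : EuclideanSpace ℝ (Fin d) × EuclideanSpace ℝ (Fin d) |
      dist q.2 (q.1 + v) ≤ s} :=
    (isClosed_le (by fun_prop) continuous_const).measurableSet
  exact measurable_measure_prodMk_left this

/-- By Lebesgue's differentiation theorem and Fatou's lemma, the mean over `w` of the probability
that `m` points fall into prescribed balls of radius of order `r` around `w` is at least of order
`r ^ (d * m)`. -/
lemma exists_pos_le_lintegral_prod {g : EuclideanSpace ℝ (Fin d) → ENNReal} (hg : Measurable g)
    (hg1 : ∫⁻ x, g x = 1) {r : ℕ → ℝ} (hr : Tendsto r atTop (nhdsWithin 0 (Set.Ioi 0)))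
    (hm : m ≠ 0) (z : Fin m → EuclideanSpace ℝ (Fin d)) {η : ℝ} (hη : 0 < η) :
    ∃ c : ENNReal, c ≠ 0 ∧ c ≠ ⊤ ∧ ∀ᶠ n in atTop, c * ENNReal.ofReal (r n ^ d) ^ m ≤
      ∫⁻ w, ∏ a, (volume.withDensity g) (Metric.ball (w + r n • z a) (r n * η)) := by
  set μ := (volume : Measure (EuclideanSpace ℝ (Fin d))).withDensity g
  have : IsFiniteMeasure μ := isFiniteMeasure_withDensity (by simp [hg1])
  set D := volume (Metric.ball (0 : EuclideanSpace ℝ (Fin d)) 1)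
  obtain ⟨M, hM⟩ : ∃ M, ∀ a, ‖z a‖ ≤ M :=
    ⟨∑ a, ‖z a‖, fun a => Finset.single_le_sum (f := fun a => ‖z a‖) (fun _ _ => norm_nonneg _)
      (Finset.mem_univ a)⟩
  -- Differentiation is applied to closed balls; halving the radius fits them into the open ones.
  set δ := η / 2
  have hδ : 0 < δ := by positivity
  have hrpos : ∀ᶠ n in atTop, 0 < r n := hr.eventually self_mem_nhdsWithin
  let φ : ℕ → EuclideanSpace ℝ (Fin d) → ENNReal := fun n w =>
    ∏ a, μ (Metric.closedBall (w + r n • z a) (r n * δ)) /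
      volume (Metric.closedBall (w + r n • z a) (r n * δ))
  have hφ : ∀ n, Measurable (φ n) := fun n => Finset.measurable_fun_prod _ fun a _ =>
    (measurable_measure_closedBall _ _).div (measurable_measure_closedBall _ _)
  have hδr : Tendsto (fun n => r n * δ) atTop (nhdsWithin 0 (Set.Ioi 0)) := by
    refine tendsto_nhdsWithin_iff.2 ⟨?_, ?_⟩
    · simpa using (hr.mono_right nhdsWithin_le_nhds).mul_const δ
    · filter_upwards [hrpos] with n hn using mul_pos hn hδ
  -- The balls are off-centre, but `w` stays within `M / δ` radii of their centres, so a Vitali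
  -- family with that constant applies.
  have hlim : ∀ᵐ w, liminf (fun n => φ n w) atTop = g w ^ m := by
    filter_upwards [(IsUnifLocDoublingMeasure.vitaliFamily volume (M / δ)).ae_tendsto_lintegral_div
      hg.aemeasurable (by simp [hg1]), ae_lt_top hg (by simp [hg1])] with w hw hwt
    refine Tendsto.liminf_eq ?_
    rw [show g w ^ m = ∏ _a : Fin m, g w by simp]
    refine ENNReal.tendsto_finsetProd_of_ne_top _ (fun a _ => ?_) fun _ _ => hwt.ne
    have h1 := hw.comp (IsUnifLocDoublingMeasure.tendsto_closedBall_filterAt volume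
      (fun n => w + r n • z a) (fun n => r n * δ) hδr (by
        filter_upwards [hrpos] with n hn
        rw [Metric.mem_closedBall, dist_eq_norm, sub_add_cancel_left, norm_neg, norm_smul,
          Real.norm_of_nonneg hn.le, show M / δ * (r n * δ) = r n * M by field_simp]
        exact mul_le_mul_of_nonneg_left (hM a) hn.le))
    refine h1.congr fun n => ?_
    simp only [Function.comp_apply, μ]
    rw [withDensity_apply _ Metric.isClosed_closedBall.measurableSet]
  have hpos : 0 < liminf (fun n => ∫⁻ w, φ n w) atTop := by
    refine lt_of_lt_of_le ?_ (lintegral_liminf_le hφ)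
    rw [lintegral_congr_ae hlim, pos_iff_ne_zero, Ne, lintegral_eq_zero_iff (hg.pow_const m)]
    intro h0
    have : g =ᵐ[volume] 0 := by
      filter_upwards [h0] with w hw
      exact (pow_eq_zero_iff hm).1 hw
    rw [lintegral_congr_ae this] at hg1
    simp at hg1
  -- The liminf may be infinite, `g` being unbounded here; a smaller positive `c` is finite.
  obtain ⟨c, hc0, hc⟩ := exists_between hpos
  have hδD : ENNReal.ofReal (δ ^ d) * D ≠ 0 :=
    mul_ne_zero (by simpa using pow_pos hδ d) volume_unitBall_ne_zero
  have hδD' : ENNReal.ofReal (δ ^ d) * D ≠ ⊤ :=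
    ENNReal.mul_ne_top ENNReal.ofReal_ne_top volume_unitBall_ne_top
  refine ⟨c * (ENNReal.ofReal (δ ^ d) * D) ^ m, mul_ne_zero hc0.ne' (pow_ne_zero _ hδD),
    ENNReal.mul_ne_top hc.ne_top (ENNReal.pow_ne_top hδD'), ?_⟩
  filter_upwards [hrpos, eventually_lt_of_lt_liminf hc] with n hn hcn
  have hvol : ∀ w a, volume (Metric.closedBall (w + r n • z a) (r n * δ)) =
      ENNReal.ofReal (r n ^ d) * (ENNReal.ofReal (δ ^ d) * D) := fun w a => by
    rw [volume_closedBall_eq _ (by positivity), mul_pow, ENNReal.ofReal_mul (by positivity),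
      mul_assoc]
  set q := ENNReal.ofReal (r n ^ d)
  set t := ENNReal.ofReal (δ ^ d) * D
  have hq : q ≠ 0 := by simpa [q] using pow_pos hn d
  have hq' : q ≠ ⊤ := ENNReal.ofReal_ne_top
  have hqt : (q * t) ^ m ≠ ⊤ := ENNReal.pow_ne_top (ENNReal.mul_ne_top hq' hδD')
  calc c * t ^ m * q ^ m = c * (q * t) ^ m := by rw [mul_pow]; ring
    _ ≤ (∫⁻ w, φ n w) * (q * t) ^ m := by gcongr
    _ = ∫⁻ w, ∏ a, μ (Metric.closedBall (w + r n • z a) (r n * δ)) := by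
      rw [← lintegral_mul_const' _ _ hqt]
      refine lintegral_congr fun w => ?_
      simp only [φ, hvol]
      rw [← Fin.prod_const, ← Finset.prod_mul_distrib]
      exact Finset.prod_congr rfl fun a _ =>
        ENNReal.div_mul_cancel (mul_ne_zero hq hδD) (ENNReal.mul_ne_top hq' hδD')
    _ ≤ _ := by
      refine lintegral_mono fun w => Finset.prod_le_prod' fun a _ => measure_mono ?_
      exact Metric.closedBall_subset_ball (by simp only [δ]; nlinarith)

/-- The probability of a cluster at given points, in terms of its mean over the position of the
cluster. -/
lemma le_measure_isCluster {μ : Measure (EuclideanSpace ℝ (Fin d))} [IsProbabilityMeasure μ]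
    {V : Type*} [Fintype V] {I : Finset V} (hI : I.card = m) (hm : m ≠ 0)
    (z : Fin m → EuclideanSpace ℝ (Fin d)) {η R r : ℝ} (hr : 0 < r) (hη : 0 < η) {b : ENNReal}
    (hb1 : b ≤ 1) (hb : ∀ w, b ≤ μ (Metric.closedBall w (r * R))ᶜ) :
    b ^ Fintype.card V * ∫⁻ w, ∏ a, μ (Metric.ball (w + r • z a) (r * η)) ≤
      Measure.pi (fun _ : V => μ) {x | IsCluster z η R r I x} *
        (ENNReal.ofReal ((r * η) ^ d) *
          volume (Metric.ball (0 : EuclideanSpace ℝ (Fin d)) 1)) := by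
  classical
  set P := Measure.pi (fun _ : V => μ)
  -- One fixed matching of points to pattern vertices suffices for a lower bound.
  let e : Fin m ≃ I := (Fintype.equivFinOfCardEq (by simpa using hI)).symm
  let S : EuclideanSpace ℝ (Fin d) → (V → EuclideanSpace ℝ (Fin d)) → Prop := fun w x =>
    (∀ a, x (e a) ∈ Metric.ball (w + r • z a) (r * η)) ∧
      ∀ j ∉ I, x j ∉ Metric.closedBall w (r * R)
  have hS : MeasurableSet {q : EuclideanSpace ℝ (Fin d) × (V → EuclideanSpace ℝ (Fin d)) |
      S q.1 q.2} := by
    refine IsOpen.measurableSet ?_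
    simp only [S, Set.ofPred_and, Set.ofPred_forall, Metric.mem_ball, Metric.mem_closedBall, not_le]
    refine IsOpen.inter ?_ ?_
    · exact isOpen_iInter_of_finite fun a => isOpen_lt (by fun_prop) continuous_const
    · exact isOpen_iInter_of_finite fun j => isOpen_iInter_of_finite fun _ =>
        isOpen_lt continuous_const (by fun_prop)
  let s : EuclideanSpace ℝ (Fin d) → V → Set (EuclideanSpace ℝ (Fin d)) := fun w j =>
    if h : j ∈ I then Metric.ball (w + r • z (e.symm ⟨j, h⟩)) (r * η)
    else (Metric.closedBall w (r * R))ᶜ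
  have hs : ∀ w, {x | S w x} = Set.pi Set.univ (s w) := by
    intro w
    ext x
    simp only [Set.mem_ofPred_eq, Set.mem_pi, Set.mem_univ, true_imp_iff, S, s]
    constructor
    · rintro ⟨h1, h2⟩ j
      by_cases hj : j ∈ I
      · rw [dif_pos hj]
        simpa using h1 (e.symm ⟨j, hj⟩)
      · rw [dif_neg hj]
        exact h2 j hj
    · intro h
      refine ⟨fun a => ?_, fun j hj => ?_⟩
      · simpa using h (e a)
      · have := h j
        rwa [dif_neg hj] at this
  have hw : ∀ w, b ^ Fintype.card V * ∏ a, μ (Metric.ball (w + r • z a) (r * η)) ≤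
      P {x | S w x} := by
    intro w
    rw [hs, Measure.pi_pi, ← Finset.prod_mul_prod_compl I, mul_comm]
    refine mul_le_mul' (le_of_eq ?_) ?_
    · rw [← Finset.prod_coe_sort I, ← e.prod_comp]
      simp [s]
    · calc b ^ Fintype.card V ≤ b ^ Iᶜ.card :=
            pow_le_pow_right_of_le_one' hb1 (Finset.card_le_univ _)
        _ ≤ _ := by
          rw [← Finset.prod_const]
          refine Finset.prod_le_prod' fun j hj => ?_
          simp only [s, dif_neg (Finset.mem_compl.1 hj)]
          exact hb w
  have hA : MeasurableSet {x : V → EuclideanSpace ℝ (Fin d) | IsCluster z η R r I x} :=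
    (isOpen_isCluster I).measurableSet
  let a₀ : Fin m := ⟨0, Nat.pos_of_ne_zero hm⟩
  calc b ^ Fintype.card V * ∫⁻ w, ∏ a, μ (Metric.ball (w + r • z a) (r * η))
      = ∫⁻ w, b ^ Fintype.card V * ∏ a, μ (Metric.ball (w + r • z a) (r * η)) := by
        rw [lintegral_const_mul' _ _ (ENNReal.pow_ne_top (hb1.trans_lt ENNReal.one_lt_top).ne)]
    _ ≤ ∫⁻ w, P {x | S w x} := lintegral_mono hw
    _ = ∫⁻ x, volume {w | S w x} ∂P := lintegral_measure_comm volume P hS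
    -- For given `x`, the admissible centres all lie in one ball of radius `r * η`, because a single
    -- point of the cluster already locates `w`.
    _ ≤ ∫⁻ x, {x | IsCluster z η R r I x}.indicator (fun _ => ENNReal.ofReal ((r * η) ^ d) *
          volume (Metric.ball (0 : EuclideanSpace ℝ (Fin d)) 1)) x ∂P := by
        refine lintegral_mono fun x => ?_
        by_cases hx : IsCluster z η R r I x
        · rw [Set.indicator_of_mem (by exact hx),
            ← volume_ball_eq (x (e a₀) - r • z a₀) (mul_pos hr hη)]
          refine measure_mono fun w hw => ?_
          have := hw.1 a₀
          rw [Metric.mem_ball, dist_comm] at this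
          rwa [Metric.mem_ball, dist_eq_norm, sub_sub_eq_add_sub, ← dist_eq_norm]
        · rw [Set.indicator_of_notMem (by exact hx)]
          have : {w | S w x} = ∅ := by
            ext w
            simp only [Set.mem_ofPred_eq, Set.mem_empty_iff_false, iff_false]
            exact fun h => hx ⟨e, w, h⟩
          rw [this, measure_empty]
    _ = _ := by rw [lintegral_indicator_const hA, mul_comm]

end Lower

/-! ### Probability of favourable coins. -/

section Coins

/-- The event that all proper faces of `I` are kept and the coin of `I` lies in `t`. -/
def coinEvent {n : ℕ} (I : Finset (Fin n)) (t : Set Bool) : Set (PosFace n → Bool) :=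
  {c | (∀ τ : PosFace n, τ.1 ⊂ I → c τ = true) ∧ ∀ τ : PosFace n, τ.1 = I → c τ ∈ t}

lemma card_filter_ssubset {V : Type*} [Fintype V] [DecidableEq V] {I : Finset V} {k i : ℕ}
    (hI : I.card = k + 2) (hi : i ∈ Finset.Icc 1 k) :
    ((Finset.univ.filter fun σ : Finset V => 2 ≤ σ.card ∧ σ ⊂ I).filter
      fun σ => σ.card - 1 = i).card = (k + 2).choose (i + 1) := by
  rw [Finset.mem_Icc] at hi
  rw [← hI, ← Finset.card_powersetCard]
  congr 1
  ext σ
  simp only [Finset.mem_filter, Finset.mem_univ, true_and, Finset.mem_powersetCard]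
  constructor
  · rintro ⟨⟨h1, h2⟩, h3⟩
    exact ⟨h2.1, by omega⟩
  · rintro ⟨h1, h2⟩
    refine ⟨⟨by omega, h1.ssubset_of_ne ?_⟩, by omega⟩
    rintro rfl
    omega

/-- The event is a product set, and the proper faces are grouped by dimension. The set `t` covers
both uses: `{false}` for Rips, everything for Čech. -/
lemma real_coinEvent {n k : ℕ} {I : Finset (Fin n)} (hI : I.card = k + 2) (t : Set Bool)
    (p : ℕ → unitInterval) :
    (Measure.pi fun σ : PosFace n => bernoulliMeasure true false (p (σ.1.card - 1))).real
        (coinEvent I t) =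
      (bernoulliMeasure true false (p (k + 1))).real t *
        ∏ i ∈ Finset.Icc 1 k, (p i : ℝ) ^ (k + 2).choose (i + 1) := by
  set u := (bernoulliMeasure true false (p (k + 1))).real t
  have hset : coinEvent I t = Set.pi Set.univ fun τ : PosFace n =>
      if τ.1 ⊂ I then {true} else if τ.1 = I then t else Set.univ := by
    ext c
    simp only [coinEvent, Set.mem_ofPred_eq, Set.mem_pi, Set.mem_univ, true_imp_iff]
    rw [← forall_and]
    refine forall_congr' fun τ => ?_
    by_cases h1 : τ.1 ⊂ I
    · simp [h1, h1.ne]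
    · by_cases h2 : τ.1 = I <;> simp [h1, h2]
  have hfac : ∀ τ : PosFace n, (bernoulliMeasure true false (p (τ.1.card - 1))).real
      (if τ.1 ⊂ I then {true} else if τ.1 = I then t else Set.univ) =
      (if τ.1 ⊂ I then (p (τ.1.card - 1) : ℝ) else 1) * if τ.1 = I then u else 1 := by
    intro τ
    by_cases h1 : τ.1 ⊂ I
    · rw [if_pos h1, if_pos h1, if_neg h1.ne, mul_one,
        bernoulliMeasure_real_apply_of_mem_of_notMem _ (Set.toFinite _).measurableSet (Set.mem_singleton _)
          (by simp)]
    · rw [if_neg h1, if_neg h1, one_mul]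
      by_cases h2 : τ.1 = I
      · rw [if_pos h2, if_pos h2, h2, hI]
        rfl
      · simp [h2]
  rw [hset, measureReal_def, Measure.pi_pi, ENNReal.toReal_prod]
  simp only [← measureReal_def]
  rw [Finset.prod_congr rfl fun τ _ => hfac τ, Finset.prod_mul_distrib, mul_comm]
  congr 1
  · rw [Finset.prod_eq_single ⟨I, by omega⟩]
    · simp
    · intro τ _ hτ
      exact if_neg fun h => hτ (Subtype.ext h)
    · simp
  · rw [← Finset.prod_subtype (Finset.univ.filter fun σ : Finset (Fin n) => 2 ≤ σ.card)
      (fun σ => by simp) (fun σ => if σ ⊂ I then (p (σ.card - 1) : ℝ) else 1),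
      ← Finset.prod_filter, Finset.filter_filter]
    rw [← Finset.prod_fiberwise_of_maps_to (t := Finset.Icc 1 k) (g := fun σ => σ.card - 1)]
    · refine Finset.prod_congr rfl fun i hi => ?_
      rw [← card_filter_ssubset hI hi, ← Finset.prod_const]
      exact Finset.prod_congr rfl fun σ hσ => by rw [(Finset.mem_filter.1 hσ).2]
    · intro σ hσ
      simp only [Finset.mem_filter, Finset.mem_univ, true_and] at hσ
      have := Finset.card_lt_card hσ.2
      rw [Finset.mem_Icc]
      omega

end Coins

/-! ### The law of a single point. -/

section Law

variable {d : ℕ} {f : EuclideanSpace ℝ (Fin d) → ℝ}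

lemma lintegral_ofReal_density (hf_nonneg : ∀ x, 0 ≤ f x) (hf_one : ∫ x, f x = 1) :
    ∫⁻ x, ENNReal.ofReal (f x) = 1 := by
  have hint : Integrable f := by
    -- The integral of a non-integrable function is `0` by convention, so the value `1` forces
    -- integrability.
    by_contra h
    rw [integral_undef h] at hf_one
    exact zero_ne_one hf_one
  rw [← ofReal_integral_eq_lintegral_ofReal hint (Eventually.of_forall hf_nonneg), hf_one,
    ENNReal.ofReal_one]

lemma isProbabilityMeasure_density (hf_nonneg : ∀ x, 0 ≤ f x) (hf_one : ∫ x, f x = 1) :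
    IsProbabilityMeasure (volume.withDensity fun x => ENNReal.ofReal (f x)) :=
  ⟨by rw [withDensity_apply _ MeasurableSet.univ, setLIntegral_univ,
    lintegral_ofReal_density hf_nonneg hf_one]⟩

lemma density_le {M : ℝ} (hM : ∀ᵐ x, f x ≤ M) (s : Set (EuclideanSpace ℝ (Fin d))) :
    (volume.withDensity fun x => ENNReal.ofReal (f x)) s ≤ ENNReal.ofReal M * volume s := by
  have := withDensity_mono (μ := volume) (f := fun x => ENNReal.ofReal (f x))
    (g := fun _ => ENNReal.ofReal M) (by
      filter_upwards [hM] with x hx using ENNReal.ofReal_le_ofReal hx) s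
  simpa [withDensity_const] using this

end Law

/-! ### Expected number of events that occur. -/

section Moments

lemma integral_card_filter {Ω ι : Type*} [MeasurableSpace Ω] (P : Measure Ω) [IsFiniteMeasure P]
    (S : Finset ι) {A : ι → Set Ω} [∀ ω, DecidablePred fun i => ω ∈ A i]
    (hA : ∀ i, MeasurableSet (A i)) :
    Integrable (fun ω => ((S.filter fun i => ω ∈ A i).card : ℝ)) P ∧
      ∫ ω, ((S.filter fun i => ω ∈ A i).card : ℝ) ∂P = ∑ i ∈ S, P.real (A i) := by
  have h : (fun ω => ((S.filter fun i => ω ∈ A i).card : ℝ)) =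
      fun ω => ∑ i ∈ S, (A i).indicator 1 ω := by
    ext ω
    rw [Finset.card_filter]
    push_cast
    exact Finset.sum_congr rfl fun i _ => by simp [Set.indicator_apply]
  have hi : ∀ i ∈ S, Integrable ((A i).indicator (1 : Ω → ℝ)) P := fun i _ =>
    (integrable_const 1).indicator (hA i)
  rw [h]
  refine ⟨integrable_finsetSum _ hi, ?_⟩
  rw [integral_finsetSum _ hi]
  exact Finset.sum_congr rfl fun i _ => integral_indicator_one (hA i)

end Moments

/-! ### Consequences of the critical scaling. -/

section Asymptotics

variable {d : ℕ} {r : ℕ → ℝ} {lam : ℝ}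

/-- In dimension zero the sequence would be `n` itself, so `d ≥ 1` is automatic. -/
lemma dim_ne_zero (hlim : Tendsto (fun n : ℕ => (n : ℝ) * r n ^ d) atTop (nhds lam)) : d ≠ 0 := by
  rintro rfl
  simp only [pow_zero, mul_one] at hlim
  exact not_tendsto_nhds_of_tendsto_atTop tendsto_natCast_atTop_atTop _ hlim

lemma eventually_bounds (hlam : 0 < lam)
    (hlim : Tendsto (fun n : ℕ => (n : ℝ) * r n ^ d) atTop (nhds lam)) :
    ∀ᶠ n : ℕ in atTop, lam / 2 ≤ n * r n ^ d ∧ n * r n ^ d ≤ 2 * lam := by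
  filter_upwards [hlim.eventually_const_lt (by linarith : lam / 2 < lam),
    hlim.eventually_lt_const (by linarith : lam < 2 * lam)] with n h1 h2 using ⟨h1.le, h2.le⟩

lemma tendsto_radius (hr : ∀ n, 0 ≤ r n) (hlam : 0 < lam)
    (hlim : Tendsto (fun n : ℕ => (n : ℝ) * r n ^ d) atTop (nhds lam)) :
    Tendsto r atTop (nhdsWithin 0 (Set.Ioi 0)) := by
  have hd := dim_ne_zero hlim
  refine tendsto_nhdsWithin_iff.2 ⟨?_, ?_⟩
  · have h := (tendsto_zero_of_tendsto_mul_atTop hlim).rpow_const (p := (d : ℝ)⁻¹)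
      (Or.inr (by positivity))
    rw [Real.zero_rpow (by positivity)] at h
    exact h.congr fun n => Real.pow_rpow_inv_natCast (hr n) hd
  · filter_upwards [eventually_bounds hlam hlim] with n hn
    refine lt_of_le_of_ne (hr n) fun h => ?_
    rw [← h, zero_pow hd, mul_zero] at hn
    linarith [hn.1]

lemma choose_mul_pow_le {n k : ℕ} {α c : ℝ} (hα : 0 ≤ α) (h : n * α ≤ c) :
    (n.choose (k + 1) : ℝ) * α ^ k ≤ c ^ k * n := by
  have h1 : (n.choose (k + 1) : ℝ) ≤ n ^ (k + 1) := by exact_mod_cast Nat.choose_le_pow n (k + 1)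
  calc (n.choose (k + 1) : ℝ) * α ^ k ≤ n ^ (k + 1) * α ^ k := by gcongr
    _ = (n * α) ^ k * n := by ring
    _ ≤ c ^ k * n := by gcongr

lemma le_choose_mul_pow {n k : ℕ} {α c : ℝ} (hc : 0 ≤ c) (h : c ≤ n * α)
    (hn : 2 * (k + 1) ≤ n) :
    c ^ k / (2 ^ (k + 1) * (k + 1).factorial) * n ≤ (n.choose (k + 1) : ℝ) * α ^ k := by
  have hn0 : (0 : ℝ) < n := by
    have : 0 < n := by omega
    exact_mod_cast this
  have hα : 0 ≤ α := by
    by_contra hneg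
    nlinarith
  have h1 := Nat.pow_le_choose (α := ℝ) (k + 1) n
  have h2 : (n : ℝ) / 2 ≤ ((n + 1 - (k + 1) : ℕ) : ℝ) := by
    rw [div_le_iff₀ two_pos]
    exact_mod_cast (by omega : n ≤ (n + 1 - (k + 1)) * 2)
  calc c ^ k / (2 ^ (k + 1) * (k + 1).factorial) * n
      ≤ (n * α) ^ k / (2 ^ (k + 1) * (k + 1).factorial) * n := by gcongr
    _ = (n / 2) ^ (k + 1) / (k + 1).factorial * α ^ k := by
      rw [div_pow]
      field_simp
      ring
    _ ≤ ((n + 1 - (k + 1) : ℕ) : ℝ) ^ (k + 1) / (k + 1).factorial * α ^ k := by gcongr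
    _ ≤ _ := by gcongr

end Asymptotics

/-! ### Expected Betti numbers. -/

section Expectation

variable {d : ℕ} {f : EuclideanSpace ℝ (Fin d) → ℝ} {r : ℕ → ℝ} {lam : ℝ}

/-- In the critical regime, given `m + 1` points form a cluster with probability at least of order
`r ^ (d * m)`. -/
lemma exists_pos_le_real_isCluster (hf_meas : Measurable f) (hf_nonneg : ∀ x, 0 ≤ f x)
    (hf_one : ∫ x, f x = 1) (hf_bdd : ∃ M : ℝ, ∀ᵐ x, f x ≤ M) (hr : ∀ n, 0 ≤ r n)
    (hlam : 0 < lam) (hlim : Tendsto (fun n : ℕ => (n : ℝ) * r n ^ d) atTop (nhds lam)) {m : ℕ}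
    (z : Fin (m + 1) → EuclideanSpace ℝ (Fin d)) {η R : ℝ} (hη : 0 < η) (hR : 0 ≤ R) :
    ∃ c : ℝ, 0 < c ∧ ∀ᶠ n : ℕ in atTop, ∀ I : Finset (Fin n), I.card = m + 1 →
      c * (r n ^ d) ^ m ≤ (Measure.pi fun _ : Fin n =>
        volume.withDensity fun x => ENNReal.ofReal (f x)).real {x | IsCluster z η R (r n) I x} := by
  have := isProbabilityMeasure_density hf_nonneg hf_one
  obtain ⟨M, hM⟩ := hf_bdd
  have hμ := density_le hM
  have hrlim := tendsto_radius hr hlam hlim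
  obtain ⟨c, hc0, hct, hc⟩ := exists_pos_le_lintegral_prod hf_meas.ennreal_ofReal
    (lintegral_ofReal_density hf_nonneg hf_one) hrlim (Nat.succ_ne_zero m) z hη
  set μ := (volume : Measure (EuclideanSpace ℝ (Fin d))).withDensity fun x => ENNReal.ofReal (f x)
  set D := volume (Metric.ball (0 : EuclideanSpace ℝ (Fin d)) 1)
  have hDt : D ≠ ⊤ := volume_unitBall_ne_top
  -- the mean number of points in a ball of radius `r n * R` is at most `n * t n`
  let t : ℕ → ℝ := fun n => max M 0 * (R ^ d * D.toReal) * r n ^ d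
  have ht0 : ∀ n, 0 ≤ t n := fun n => by have := hr n; positivity
  have htlim : Tendsto (fun n : ℕ => (n : ℝ) * -t n) atTop
      (nhds (-(max M 0 * (R ^ d * D.toReal) * lam))) :=
    ((hlim.const_mul (max M 0 * (R ^ d * D.toReal))).neg).congr fun n => by simp only [t]; ring
  -- The isolation factor `(1 - t n) ^ n` tends to a positive limit; this is where the critical
  -- regime enters.
  have hexp := Real.tendsto_one_add_pow_exp_of_tendsto htlim
  set L := Real.exp (-(max M 0 * (R ^ d * D.toReal) * lam))
  have hL : 0 < L := Real.exp_pos _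
  have ht1 : ∀ᶠ n in atTop, t n ≤ 1 := by
    have := (tendsto_zero_of_tendsto_mul_atTop htlim).neg
    simp only [neg_neg, neg_zero] at this
    filter_upwards [this.eventually_lt_const one_pos] with n hn using hn.le
  set s := ENNReal.ofReal (η ^ d) * D
  have hs0 : s ≠ 0 := mul_ne_zero (by simpa using pow_pos hη d) volume_unitBall_ne_zero
  have hst : s ≠ ⊤ := ENNReal.mul_ne_top ENNReal.ofReal_ne_top hDt
  have hb0 : ENNReal.ofReal (L / 2) ≠ 0 := by simpa using hL
  set C := ENNReal.ofReal (L / 2) * c / s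
  have hC0 : C ≠ 0 := ENNReal.div_ne_zero.2 ⟨mul_ne_zero hb0 hc0, hst⟩
  have hCt : C ≠ ⊤ := ENNReal.div_ne_top (ENNReal.mul_ne_top ENNReal.ofReal_ne_top hct) hs0
  refine ⟨C.toReal, ENNReal.toReal_pos hC0 hCt, ?_⟩
  filter_upwards [hc, hexp.eventually_const_lt (half_lt_self hL), ht1,
    hrlim.eventually self_mem_nhdsWithin] with n hcn hLn htn hrn I hI
  have hrn0 : 0 < r n := hrn
  have hb : ∀ w, ENNReal.ofReal (1 - t n) ≤ μ (Metric.closedBall w (r n * R))ᶜ := by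
    intro w
    rw [prob_compl_eq_one_sub Metric.isClosed_closedBall.measurableSet,
      ENNReal.ofReal_sub _ (ht0 n), ENNReal.ofReal_one]
    refine tsub_le_tsub_left ?_ 1
    refine (measure_closedBall_le hμ w (mul_nonneg hrn0.le hR)).trans (le_of_eq ?_)
    simp only [t]
    rw [ENNReal.ofReal_mul (by positivity), ENNReal.ofReal_mul (by positivity),
      ENNReal.ofReal_mul (by positivity), ENNReal.ofReal_toReal hDt, mul_pow,
      ENNReal.ofReal_mul (by positivity), ENNReal.ofReal_max, ENNReal.ofReal_zero,
      max_eq_left zero_le]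
    ring
  have h1 := le_measure_isCluster hI (Nat.succ_ne_zero m) z hrn0 hη (μ := μ)
    (by rw [ENNReal.ofReal_le_one]; linarith [ht0 n]) hb
  rw [Fintype.card_fin, ← ENNReal.ofReal_pow (by linarith), mul_pow,
    ENNReal.ofReal_mul (by positivity), mul_assoc (ENNReal.ofReal (r n ^ d))] at h1
  set q := ENNReal.ofReal (r n ^ d)
  set P := Measure.pi (fun _ : Fin n => μ)
  have hq : q ≠ 0 := by simpa [q] using pow_pos hrn0 d
  have hqt : q ≠ ⊤ := ENNReal.ofReal_ne_top
  -- The integral over centres has order `q ^ (m + 1)`; one factor `q` is the volume of the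
  -- admissible centres and cancels.
  have h2 : C * q ^ m ≤ P {x | IsCluster z η R (r n) I x} := by
    have h3 : ENNReal.ofReal (L / 2) * (c * q ^ (m + 1)) ≤
        P {x | IsCluster z η R (r n) I x} * (q * s) :=
      (mul_le_mul' (ENNReal.ofReal_le_ofReal (by
        rw [sub_eq_add_neg]; exact hLn.le)) hcn).trans h1
    refine (ENNReal.mul_le_mul_iff_left (mul_ne_zero hq hs0) (ENNReal.mul_ne_top hqt hst)).1
      (le_of_eq_of_le ?_ h3)
    calc C * q ^ m * (q * s) = C * s * (q ^ m * q) := by ring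
      _ = ENNReal.ofReal (L / 2) * (c * q ^ (m + 1)) := by
        rw [ENNReal.div_mul_cancel hs0 hst, pow_succ]
        ring
  have h4 := ENNReal.toReal_mono (measure_ne_top P _) h2
  rwa [ENNReal.toReal_mul, ENNReal.toReal_pow, ENNReal.toReal_ofReal (by positivity)] at h4

lemma isProbabilityMeasure_law (hf_nonneg : ∀ x, 0 ≤ f x) (hf_one : ∫ x, f x = 1)
    (p : ℕ → unitInterval) (n : ℕ) : IsProbabilityMeasure (law f p n) := by
  have := isProbabilityMeasure_density hf_nonneg hf_one
  unfold law
  infer_instance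

variable (F : Type*) [Field F] {k : ℕ}
  {K : ∀ n, (Fin n → EuclideanSpace ℝ (Fin d)) → PreAbstractSimplicialComplex (Fin n)}
  {p : ℕ → ℕ → unitInterval}

lemma integrable_betti_soften (hf_nonneg : ∀ x, 0 ≤ f x) (hf_one : ∫ x, f x = 1)
    (hK : ∀ n σ, MeasurableSet {x | σ ∈ K n x}) (k n : ℕ) :
    Integrable (fun ω => (betti F (soften (K n ω.1) ω.2) k : ℝ)) (law f (p n) n) := by
  have := isProbabilityMeasure_law hf_nonneg hf_one (p n) n
  exact integrable_betti F (measurableSet_mem_soften (hK n)) k _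

/-- The expected Betti numbers of soft subcomplexes of the Rips complex are at most linear. -/
lemma isBigO_integral_betti (hf_nonneg : ∀ x, 0 ≤ f x)
    (hf_one : ∫ x, f x = 1) (hf_bdd : ∃ M : ℝ, ∀ᵐ x, f x ≤ M) (hr : ∀ n, 0 ≤ r n)
    (hlam : 0 < lam) (hlim : Tendsto (fun n : ℕ => (n : ℝ) * r n ^ d) atTop (nhds lam))
    (hK : ∀ n σ, MeasurableSet {x | σ ∈ K n x})
    (hrips : ∀ n x σ, σ ∈ K n x → σ ∈ rips x (r n)) :
    (fun n : ℕ => ∫ ω, (betti F (soften (K n ω.1) ω.2) k : ℝ) ∂(law f (p n) n))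
      =O[atTop] fun n : ℕ => (n : ℝ) := by
  classical
  have := isProbabilityMeasure_density hf_nonneg hf_one
  obtain ⟨M, hM⟩ := hf_bdd
  set μ := (volume : Measure (EuclideanSpace ℝ (Fin d))).withDensity fun x => ENNReal.ofReal (f x)
  set D := volume (Metric.ball (0 : EuclideanSpace ℝ (Fin d)) 1)
  let A : ℝ := (ENNReal.ofReal M).toReal * (2 ^ d * D.toReal)
  refine IsBigO.of_bound (2 ^ d * A ^ k * (2 * lam) ^ k) ?_
  filter_upwards [eventually_bounds hlam hlim,
    (tendsto_radius hr hlam hlim).eventually self_mem_nhdsWithin] with n hn hrn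
  have hrn0 : 0 < r n := hrn
  have hlaw := isProbabilityMeasure_law hf_nonneg hf_one (p n) n
  rw [Real.norm_of_nonneg (integral_nonneg fun ω => Nat.cast_nonneg _),
    Real.norm_of_nonneg (Nat.cast_nonneg n)]
  let B : Finset (Fin n) → Set ((Fin n → EuclideanSpace ℝ (Fin d)) × (PosFace n → Bool)) :=
    fun σ => {x | σ ∈ rips x (r n)} ×ˢ Set.univ
  have hB : ∀ σ, MeasurableSet (B σ) := fun σ =>
    (measurableSet_mem_rips σ (r n)).prod MeasurableSet.univ
  obtain ⟨hint, hsum⟩ := integral_card_filter (law f (p n) n)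
    (Finset.powersetCard (k + 1) (Finset.univ : Finset (Fin n))) hB
  have hprob : ∀ σ ∈ Finset.powersetCard (k + 1) (Finset.univ : Finset (Fin n)),
      (law f (p n) n).real (B σ) ≤ 2 ^ d * A ^ k * (r n ^ d) ^ k := by
    intro σ hσ
    unfold law
    rw [measureReal_prod_prod, probReal_univ, mul_one]
    have h1 := measure_pairwise_dist_le ENNReal.ofReal_ne_top (density_le hM)
      (Finset.mem_powersetCard.1 hσ).2 hrn0
    have h2 := (measure_mono fun x (hx : σ ∈ rips x (r n)) => (mem_rips_iff.1 hx).2).trans h1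
    have h3 := ENNReal.toReal_mono (ENNReal.mul_ne_top ENNReal.ofReal_ne_top
      (ENNReal.pow_ne_top (ENNReal.mul_ne_top ENNReal.ofReal_ne_top
        (ENNReal.mul_ne_top ENNReal.ofReal_ne_top volume_unitBall_ne_top)))) h2
    refine h3.trans (le_of_eq ?_)
    rw [ENNReal.toReal_mul, ENNReal.toReal_pow, ENNReal.toReal_mul, ENNReal.toReal_mul,
      ENNReal.toReal_ofReal (by positivity),
      ENNReal.toReal_ofReal (r := (2 * r n) ^ d) (by positivity), mul_pow 2 (r n) d, mul_assoc _ (A ^ k), ← mul_pow A]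
    simp only [A, D]
    congr 2
    ring
  calc ∫ ω, (betti F (soften (K n ω.1) ω.2) k : ℝ) ∂(law f (p n) n)
      ≤ ∫ ω, (((Finset.powersetCard (k + 1) (Finset.univ : Finset (Fin n))).filter
          fun σ => ω ∈ B σ).card : ℝ) ∂(law f (p n) n) := by
        refine integral_mono (integrable_betti_soften F hf_nonneg hf_one hK k n) hint fun ω => ?_
        dsimp only
        norm_cast
        refine betti_le_card F fun σ hσ hc => Finset.mem_filter.2 ⟨?_, ?_⟩
        · simpa using hc
        · exact ⟨hrips n _ σ hσ.1, Set.mem_univ _⟩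
    _ ≤ ∑ σ ∈ Finset.powersetCard (k + 1) (Finset.univ : Finset (Fin n)),
          2 ^ d * A ^ k * (r n ^ d) ^ k := hsum.le.trans (Finset.sum_le_sum hprob)
    _ = 2 ^ d * A ^ k * ((n.choose (k + 1) : ℝ) * (r n ^ d) ^ k) := by
      rw [Finset.sum_const, Finset.card_powersetCard, Finset.card_univ, Fintype.card_fin,
        nsmul_eq_mul]
      ring
    _ ≤ 2 ^ d * A ^ k * ((2 * lam) ^ k * n) := by
      have hA : 0 ≤ A := by positivity
      exact mul_le_mul_of_nonneg_left (choose_mul_pow_le (by positivity) hn.2) (by positivity)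
    _ = _ := by ring

/-- If clusters of points whose coins are favourable are isolated spheres of the soft complex,
then the expected Betti number is at least of order `n ^ (1 - ε)`. -/
lemma isBigO_rpow_integral_betti (hf_meas : Measurable f) (hf_nonneg : ∀ x, 0 ≤ f x)
    (hf_one : ∫ x, f x = 1) (hf_bdd : ∃ M : ℝ, ∀ᵐ x, f x ≤ M) (hr : ∀ n, 0 ≤ r n)
    (hlam : 0 < lam) (hlim : Tendsto (fun n : ℕ => (n : ℝ) * r n ^ d) atTop (nhds lam))
    (hK : ∀ n σ, MeasurableSet {x | σ ∈ K n x})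
    (hrips : ∀ n x σ, σ ∈ K n x → σ ∈ rips x (r n))
    (z : Fin (k + 2) → EuclideanSpace ℝ (Fin d)) {η : ℝ} (hη : 0 < η) (t : Set Bool)
    (hfaces : ∀ n, 0 < r n → ∀ x R I τ, IsCluster z η R (r n) I x → τ ⊂ I → τ.Nonempty → τ ∈ K n x)
    (hhole : ∀ n, 0 < r n → ∀ x R I c, I.card = k + 2 → IsCluster z η R (r n) I x →
      c ∈ coinEvent I t → I ∉ soften (K n x) c)
    {ε : ℝ} (hp : ∀ᶠ n : ℕ in atTop, 1 / (n : ℝ) ^ ε ≤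
      (bernoulliMeasure true false (p n (k + 1))).real t *
        ∏ i ∈ Finset.Icc 1 k, (p n i : ℝ) ^ (k + 2).choose (i + 1)) :
    (fun n : ℕ => (n : ℝ) ^ (1 - ε)) =O[atTop]
      fun n : ℕ => ∫ ω, (betti F (soften (K n ω.1) ω.2) k : ℝ) ∂(law f (p n) n) := by
  classical
  have := isProbabilityMeasure_density hf_nonneg hf_one
  obtain ⟨ρ, hρ⟩ : ∃ ρ, ∀ a, ‖z a‖ + η ≤ ρ :=
    ⟨∑ a, ‖z a‖ + η, fun a => by
      gcongr
      exact Finset.single_le_sum (f := fun a => ‖z a‖) (fun _ _ => norm_nonneg _)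
        (Finset.mem_univ a)⟩
  have hρ0 : 0 ≤ ρ := (add_nonneg (norm_nonneg _) hη.le).trans (hρ 0)
  -- Large enough for both `IsCluster.disjoint` and `IsCluster.lt_dist`.
  set R := 3 * ρ + 1
  obtain ⟨c, hc0, hc⟩ := exists_pos_le_real_isCluster hf_meas hf_nonneg hf_one hf_bdd hr hlam hlim
    (m := k + 1) z hη (by positivity : 0 ≤ R)
  set b : ℝ := (lam / 2) ^ (k + 1) / (2 ^ (k + 1 + 1) * (k + 1 + 1).factorial)
  have hb : 0 < b := by positivity
  refine IsBigO.of_bound (b * c)⁻¹ ?_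
  filter_upwards [hc, eventually_bounds hlam hlim, hp, eventually_ge_atTop (2 * (k + 1 + 1)),
    (tendsto_radius hr hlam hlim).eventually self_mem_nhdsWithin] with n hcn hn hpn hnk hrn
  have hrn0 : 0 < r n := hrn
  have hn0 : (0 : ℝ) < n := by
    have : 0 < n := by omega
    exact_mod_cast this
  have hlaw := isProbabilityMeasure_law hf_nonneg hf_one (p n) n
  rw [Real.norm_of_nonneg (integral_nonneg fun ω => Nat.cast_nonneg _),
    Real.norm_of_nonneg (Real.rpow_nonneg hn0.le _), le_inv_mul_iff₀ (by positivity)]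
  let A : Finset (Fin n) → Set ((Fin n → EuclideanSpace ℝ (Fin d)) × (PosFace n → Bool)) :=
    fun I => {x | IsCluster z η R (r n) I x} ×ˢ coinEvent I t
  have hA : ∀ I, MeasurableSet (A I) := fun I =>
    (isOpen_isCluster I).measurableSet.prod (Set.toFinite _).measurableSet
  obtain ⟨hint, hsum⟩ := integral_card_filter (law f (p n) n)
    (Finset.powersetCard (k + 2) (Finset.univ : Finset (Fin n))) hA
  have hprob : ∀ I ∈ Finset.powersetCard (k + 2) (Finset.univ : Finset (Fin n)),
      c * (r n ^ d) ^ (k + 1) * (1 / (n : ℝ) ^ ε) ≤ (law f (p n) n).real (A I) := by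
    intro I hI
    have hIc := (Finset.mem_powersetCard.1 hI).2
    unfold law
    rw [measureReal_prod_prod, real_coinEvent hIc]
    exact mul_le_mul (hcn I hIc) hpn (by positivity) measureReal_nonneg
  calc b * c * (n : ℝ) ^ (1 - ε) = b * n * (c * (1 / (n : ℝ) ^ ε)) := by
        rw [Real.rpow_sub hn0, Real.rpow_one]
        ring
    _ ≤ (n.choose (k + 2) : ℝ) * (r n ^ d) ^ (k + 1) * (c * (1 / (n : ℝ) ^ ε)) := by
      exact mul_le_mul_of_nonneg_right (le_choose_mul_pow (by positivity) hn.1 hnk) (by positivity)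
    _ = ∑ I ∈ Finset.powersetCard (k + 2) (Finset.univ : Finset (Fin n)),
          c * (r n ^ d) ^ (k + 1) * (1 / (n : ℝ) ^ ε) := by
      rw [Finset.sum_const, Finset.card_powersetCard, Finset.card_univ, Fintype.card_fin,
        nsmul_eq_mul]
      ring
    _ ≤ ∫ ω, (((Finset.powersetCard (k + 2) (Finset.univ : Finset (Fin n))).filter
          fun I => ω ∈ A I).card : ℝ) ∂(law f (p n) n) := (Finset.sum_le_sum hprob).trans hsum.ge
    _ ≤ _ := by
      refine integral_mono hint (integrable_betti_soften F hf_nonneg hf_one hK k n) fun ω => ?_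
      dsimp only
      norm_cast
      refine card_le_betti F (fun I hI => ?_) fun I hI J hJ hne => ?_
      · obtain ⟨hI, hcl, hco⟩ := Finset.mem_filter.1 hI
        have hIc := (Finset.mem_powersetCard.1 hI).2
        refine ⟨hIc, fun τ hτ hne => ⟨hfaces n hrn0 _ R I τ hcl hτ hne, fun σ hσ =>
          hco.1 σ (Finset.ssubset_of_subset_of_ssubset hσ hτ)⟩, hhole n hrn0 _ R I _ hIc hcl hco,
          fun i hi j hj hij => ?_⟩
        have h1 := (mem_rips_iff.1 (hrips n _ _ hij.1)).2 i (by simp) j (by simp)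
        exact absurd h1 (not_le.2 (IsCluster.lt_dist hrn0 hρ (by simp only [R]; linarith)
          hcl hi hj))
      · exact IsCluster.disjoint hrn0 hρ (by simp only [R]; linarith)
          (Finset.mem_filter.1 hI).2.1 (Finset.mem_filter.1 hJ).2.1 hne

end Expectation

end SoftComplex

/-! ### Assembly for the two complexes. -/

theorem mainTheorem5 (F : Type*) [Field F] (d k : ℕ)
    -- the common density of the points: bounded (a.e.)
    (f : EuclideanSpace ℝ (Fin d) → ℝ) (hf_meas : Measurable f) (hf_nonneg : ∀ x, 0 ≤ f x)
    (hf_one : ∫ x, f x = 1) (hf_bdd : ∃ M : ℝ, ∀ᵐ x, f x ≤ M)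
    -- the radius `r n` and the multiparameter `p n = (p₁, p₂, …)`, depending on `n`
    (r : ℕ → ℝ) (hr : ∀ n, 0 ≤ r n) (p : ℕ → ℕ → unitInterval)
    (ε : ℝ) (hε : 0 < ε) (lam : ℝ) (hlam : 0 < lam)
    (hlim : Tendsto (fun n : ℕ => (n : ℝ) * r n ^ d) atTop (nhds lam)) :
    -- the Betti numbers have expectations
    (∀ n, Integrable (SoftComplex.ripsBetti F k n (r n)) (SoftComplex.law f (p n) n)) ∧
    (∀ n, Integrable (SoftComplex.cechBetti F k n (r n)) (SoftComplex.law f (p n) n)) ∧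
    -- soft Vietoris–Rips complex
    ((∀ᶠ n : ℕ in atTop,
        1 / (n : ℝ) ^ ε ≤ (1 - (p n (k + 1) : ℝ)) *
          ∏ i ∈ Finset.Icc 1 k, (p n i : ℝ) ^ (k + 2).choose (i + 1)) →
      (fun n : ℕ => ∫ ω, SoftComplex.ripsBetti F k n (r n) ω ∂(SoftComplex.law f (p n) n))
          =O[atTop] (fun n : ℕ => (n : ℝ)) ∧
      (fun n : ℕ => (n : ℝ) ^ (1 - ε)) =O[atTop]
        (fun n : ℕ => ∫ ω, SoftComplex.ripsBetti F k n (r n) ω ∂(SoftComplex.law f (p n) n))) ∧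
    -- soft Čech complex
    ((∀ᶠ n : ℕ in atTop,
        1 / (n : ℝ) ^ ε ≤ ∏ i ∈ Finset.Icc 1 k, (p n i : ℝ) ^ (k + 2).choose (i + 1)) →
      (fun n : ℕ => ∫ ω, SoftComplex.cechBetti F k n (r n) ω ∂(SoftComplex.law f (p n) n))
          =O[atTop] (fun n : ℕ => (n : ℝ)) ∧
      (k < d → (fun n : ℕ => (n : ℝ) ^ (1 - ε)) =O[atTop]
        (fun n : ℕ => ∫ ω, SoftComplex.cechBetti F k n (r n) ω ∂(SoftComplex.law f (p n) n)))) := by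
  have hrips : ∀ n (x : Fin n → EuclideanSpace ℝ (Fin d)) σ, σ ∈ SoftComplex.rips x (r n) →
      σ ∈ SoftComplex.rips x (r n) := fun _ _ _ h => h
  have hcech : ∀ n (x : Fin n → EuclideanSpace ℝ (Fin d)) σ, σ ∈ SoftComplex.cech x (r n) →
      σ ∈ SoftComplex.rips x (r n) := fun _ _ _ h => SoftComplex.cech_le_rips h
  have hmr : ∀ n σ, MeasurableSet {x : Fin n → EuclideanSpace ℝ (Fin d) |
      σ ∈ SoftComplex.rips x (r n)} := fun n σ => SoftComplex.measurableSet_mem_rips σ (r n)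
  have hmc : ∀ n σ, MeasurableSet {x : Fin n → EuclideanSpace ℝ (Fin d) |
      σ ∈ SoftComplex.cech x (r n)} := fun n σ => SoftComplex.measurableSet_mem_cech σ (r n)
  refine ⟨SoftComplex.integrable_betti_soften F
      (K := fun n x => SoftComplex.rips x (r n)) (p := p) hf_nonneg hf_one hmr k,
    SoftComplex.integrable_betti_soften F
      (K := fun n x => SoftComplex.cech x (r n)) (p := p) hf_nonneg hf_one hmc k,
    fun hp => ⟨SoftComplex.isBigO_integral_betti F
      (K := fun n x => SoftComplex.rips x (r n)) (p := p)
      hf_nonneg hf_one hf_bdd hr hlam hlim hmr hrips,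
      ?_⟩,
    fun hp => ⟨SoftComplex.isBigO_integral_betti F
      (K := fun n x => SoftComplex.cech x (r n)) (p := p)
      hf_nonneg hf_one hf_bdd hr hlam hlim hmc hcech,
      fun hk => ?_⟩⟩
  -- Rips: all points gather around one centre, and `{false}` makes the coin delete the top face.
  · refine SoftComplex.isBigO_rpow_integral_betti F
      (K := fun n x => SoftComplex.rips x (r n)) (p := p)
      hf_meas hf_nonneg hf_one hf_bdd hr hlam hlim hmr hrips
      (fun _ => 0) one_half_pos {false} ?_ ?_ (hp.mono fun n hn => ?_)
    · exact fun n _ x R I τ hI hτ hne => hI.mem_rips hτ.1 hne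
    · intro n _ x R I c hIc _ hc hI
      have h1 : c ⟨I, by omega⟩ = false := hc.2 ⟨I, by omega⟩ rfl
      rw [hI.2 ⟨I, by omega⟩ subset_rfl] at h1
      exact absurd h1 (by decide)
    · rwa [bernoulliMeasure_real_apply_of_notMem_of_mem _ (Set.toFinite _).measurableSet
        (by simp) (Set.mem_singleton _)]
  -- Čech: the geometry makes the hole, so the coin of `I` is left free by `Set.univ`.
  · obtain ⟨z, η, hη, hz⟩ := SoftComplex.exists_isHollow hk
    refine SoftComplex.isBigO_rpow_integral_betti F
      (K := fun n x => SoftComplex.cech x (r n)) (p := p)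
      hf_meas hf_nonneg hf_one hf_bdd hr hlam hlim hmc hcech z hη Set.univ ?_ ?_ (hp.mono fun n hn => ?_)
    · exact fun n hn x R I τ hI hτ hne => hI.mem_cech hn hz hτ hne
    · exact fun n hn x R I c _ hI _ h => hI.notMem_cech hn hz h.1
    · simpa using hn
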